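/- Let $n\ge 0$ be an integer (the interesting case is $n\ge 2$), and let $\mathfrak g$ be a finite-dimensional simple Lie algebra over $\mathbb C$ with a nondegenerate symmetric invariant bilinear form $(\cdot|\cdot)$. For $u\in\mathbb C^n$ and $r\in\mathbb Z^n$ put $(u|r)=\sum_i u_ir_i$. *Full toroidal algebra.* Let $A_n=\mathbb C[t_1^{\pm1},\dots,t_n^{\pm1}]$, let $\Omega_{A_n}$ have basis $t^kK_i$ ($k\in\mathbb Z^n$, $1\le i\le n$), let $dA_n$ be the span of the elements $\sum_i k_i t^kK_i$, and let $\mathrm{Der}(A_n)$ have basis $t^kd_i$. Fix $c_1,c_2\in\mathbb C$ and put $\phi=c_1\phi_1+c_2\phi_2$, where $\phi_1(t^pd_a,t^qd_b)=-q_ap_b\sum_ip_it^{p+q}K_i$ and $\phi_2(t^pd_a,t^qd_b)=-p_aq_b\sum_ip_it^{p+q}K_i$. The Lie algebra $(\mathfrak g\otimes A_n)\oplus\Omega_{A_n}/dA_n\oplus\mathrm{Der}(A_n)$ has the brackets $$[x\otimes t^p,y\otimes t^q]=[x,y]\otimes t^{p+q}+(x|y)\sum_ip_it^{p+q}K_i,\qquad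 [t^pd_a,x\otimes t^q]=q_a\,x\otimes t^{p+q},$$ $$[t^pd_a,t^qK_b]=q_at^{p+q}K_b+\delta_{ab}\sum_ip_it^{p+q}K_i,\qquad [t^pd_a,t^qd_b]=q_at^{p+q}d_b-p_bt^{p+q}d_a+\phi(t^pd_a,t^qd_b),$$ and $\Omega_{A_n}/dA_n$ commutes with itself and with $\mathfrak g\otimes A_n$. *Lie torus.* Let $\sigma_1,\dots,\sigma_n$ be commuting automorphisms of $\mathfrak g$ of finite orders $m_1,\dots,m_n$, let $\zeta_i$ be a primitive $m_i$-th root of unity, $\Gamma=m_1\mathbb Z\oplus\cdots\oplus m_n\mathbb Z$, and $\mathfrak g(\bar k)=\{x\in\mathfrak g:\sigma_i(x)=\zeta_i^{k_i}x\ \text{for all } i\}$ for $k\in\mathbb Z^n$. Suppose $LT=\bigoplus_{k\in\mathbb Z^n}\mathfrak g(\bar k)\otimes t^k$ is a Lie torus, that is: (1) $\mathfrak g(\bar 0)$ is simple; let $\mathfrak h(\bar 0)$ be a Cartan subalgebra of it and $\Delta_0^\times$ its root system. (2) For each $k\notin\Gamma$, $\mathfrak g(\bar k)=U\oplus W$ as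 a $\mathfrak g(\bar 0)$-module, where $U$ is trivial and $W$ is either zero or irreducible of dimension $>1$ with all $\mathfrak h(\bar 0)$-weights in $\Delta_{0,en}$. Here $\Delta_{0,en}=\{0\}\cup\Delta_0^\times\cup 2\Delta_{0,sh}^\times$ if $\Delta_0^\times$ is of type $B_l$, $l\ge1$ (with $B_1=A_1$, whose roots are all short; $\Delta_{0,sh}^\times$ is the set of short roots), and $\Delta_{0,en}=\{0\}\cup\Delta_0^\times$ otherwise. (3) The group generated by $\sigma_1,\dots,\sigma_n$ has order $m_1\cdots m_n$. *Twisted toroidal extended affine Lie algebra.* For $u\in\mathbb C^n$ and $r\in\mathbb Z^n$ let $D(u,r)=\sum_iu_it^rd_i$. Let $\Omega_{A_n(m)}/d_{A_n(m)}$ be the span of the classes of $t^rK_i$ with $r\in\Gamma$, let $S_n(m)$ be the span of the $D(u,r)$ with $r\in\Gamma$ and $(u|r)=0$, and let $\tau=LT\oplus\Omega_{A_n(m)}/d_{A_n(m)}\oplus S_n(m)$, a subalgebra of the Lie algebra above. Let $K_i=t^0K_i$, $d_i=t^0d_i$ and $H=\mathfrak h(\bar 0)\oplus\sum_i\mathbb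 CK_i\oplus\sum_i\mathbb Cd_i$. A $\tau$-module $V$ is *integrable* if it is the direct sum of its weight spaces $V_\lambda=\{v: hv=\lambda(h)v\ \text{for all } h\in H\}$ ($\lambda\in H^*$), these are finite-dimensional, and for all $k\in\mathbb Z^n$, all $0\ne\alpha\in\Delta_{0,en}$ and all $x\in\mathfrak g(\bar k)$ with $[h,x]=\alpha(h)x$ for all $h\in\mathfrak h(\bar 0)$, the element $x\otimes t^k$ acts locally nilpotently on $V$. **Proposition.** Let $V$ be an irreducible integrable $\tau$-module on which $K_1,\dots,K_n$ act trivially (as zero). Then $\Omega_{A_n(m)}/d_{A_n(m)}$ acts trivially on $V$, that is, $zv=0$ for all $z\in\Omega_{A_n(m)}/d_{A_n(m)}$ and all $v\in V$. -/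

import Mathlib

open scoped Matrix

noncomputable section

namespace ToroidalEALA

/-- A nondegenerate symmetric invariant bilinear form `(·|·)` on the Lie algebra `g`. -/
structure InvariantForm (g : Type*) [LieRing g] [LieAlgebra ℂ g] where
  form : LinearMap.BilinForm ℂ g
  symm : ∀ x y, form x y = form y x
  invariant : ∀ x y z, form ⁅x, y⁆ z = form x ⁅y, z⁆
  nondegenerate : form.Nondegenerate

/-- Exponents `k ∈ ℤⁿ`. -/
abbrev Exponent (n : ℕ) : Type := Fin n → ℤ

/-- The integer vector `k`, regarded as a vector of `ℂⁿ`. -/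
def cvec {n : ℕ} (k : Exponent n) : Fin n → ℂ := fun i => (k i : ℂ)

theorem cvec_add {n : ℕ} (k l : Exponent n) : cvec (k + l) = cvec k + cvec l := by
  ext i; simp [cvec]

theorem cvec_zero {n : ℕ} : cvec (0 : Exponent n) = 0 := by
  ext i; simp [cvec]

section FullToroidal

variable (n : ℕ) {g : Type*} [LieRing g] [LieAlgebra ℂ g]

variable (g) in
/-- The coefficient space of a fixed degree `k ∈ ℤⁿ`: a triple `(x, a, u)` stands for
`x ⊗ t^k + ∑ i, a i • t^k K_i + ∑ i, u i • t^k d_i`. -/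
abbrev Coeff : Type _ := g × (Fin n → ℂ) × (Fin n → ℂ)

variable (g) in
/-- The space `(g ⊗ A_n) ⊕ Ω_{A_n} ⊕ Der(A_n)`, written by its `ℤⁿ`-homogeneous components. -/
abbrev PreToroidal : Type _ := Exponent n →₀ Coeff n g

variable (g) in
/-- The subspace `dA_n` of `Ω_{A_n}`, spanned by the elements `∑ i, k_i t^k K_i`. -/
def exactForms : Submodule ℂ (PreToroidal n g) :=
  Submodule.span ℂ (Set.range fun k : Exponent n =>
    (Finsupp.single k (0, cvec k, 0) : PreToroidal n g))

variable {n}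

/-- The bracket of an element of degree `p` with an element of degree `q` (with values in
degree `p + q`).  The last two summands of the `K`-component are the cocycle
`c₁ φ₁ + c₂ φ₂`, where
`φ₁(t^p d_a, t^q d_b) = - q_a p_b ∑ i, p_i t^{p+q} K_i` and
`φ₂(t^p d_a, t^q d_b) = - p_a q_b ∑ i, p_i t^{p+q} K_i`. -/
def bracketFun (B : InvariantForm g) (c₁ c₂ : ℂ) (p q : Exponent n) (e f : Coeff n g) :
    Coeff n g :=
  (⁅e.1, f.1⁆ + (e.2.2 ⬝ᵥ cvec q) • f.1 - (f.2.2 ⬝ᵥ cvec p) • e.1,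
    B.form e.1 f.1 • cvec p
      + ((e.2.2 ⬝ᵥ cvec q) • f.2.1 + (e.2.2 ⬝ᵥ f.2.1) • cvec p)
      - ((f.2.2 ⬝ᵥ cvec p) • e.2.1 + (f.2.2 ⬝ᵥ e.2.1) • cvec q)
      - (c₁ * (e.2.2 ⬝ᵥ cvec q) * (f.2.2 ⬝ᵥ cvec p)) • cvec p
      - (c₂ * (e.2.2 ⬝ᵥ cvec p) * (f.2.2 ⬝ᵥ cvec q)) • cvec p,
    (e.2.2 ⬝ᵥ cvec q) • f.2.2 - (f.2.2 ⬝ᵥ cvec p) • e.2.2)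

/-- `bracketFun` as a bilinear map. -/
def bracketHom (B : InvariantForm g) (c₁ c₂ : ℂ) (p q : Exponent n) :
    Coeff n g →ₗ[ℂ] Coeff n g →ₗ[ℂ] Coeff n g :=
  LinearMap.mk₂ ℂ (bracketFun B c₁ c₂ p q)
    (by
      rintro ⟨x, a, u⟩ ⟨x', a', u'⟩ ⟨y, b, w⟩
      simp only [bracketFun, Prod.mk_add_mk, Prod.mk.injEq, add_lie, add_dotProduct,
        dotProduct_add, map_add, LinearMap.add_apply]
      refine ⟨by module, by module, by module⟩)
    (by
      rintro c ⟨x, a, u⟩ ⟨y, b, w⟩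
      simp only [bracketFun, Prod.smul_mk, Prod.mk.injEq, smul_lie, smul_dotProduct,
        dotProduct_smul, map_smul, LinearMap.smul_apply, smul_eq_mul]
      refine ⟨by module, by module, by module⟩)
    (by
      rintro ⟨x, a, u⟩ ⟨y, b, w⟩ ⟨y', b', w'⟩
      simp only [bracketFun, Prod.mk_add_mk, Prod.mk.injEq, lie_add, add_dotProduct,
        dotProduct_add, map_add]
      refine ⟨by module, by module, by module⟩)
    (by
      rintro c ⟨x, a, u⟩ ⟨y, b, w⟩
      simp only [bracketFun, Prod.smul_mk, Prod.mk.injEq, lie_smul, smul_dotProduct,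
        dotProduct_smul, map_smul, smul_eq_mul]
      refine ⟨by module, by module, by module⟩)

/-- The bilinear extension of `bracketFun` to sums of homogeneous elements. -/
def preBracket (B : InvariantForm g) (c₁ c₂ : ℂ) :
    PreToroidal n g →ₗ[ℂ] PreToroidal n g →ₗ[ℂ] PreToroidal n g :=
  Finsupp.lsum ℂ fun p => LinearMap.flip (Finsupp.lsum ℂ fun q =>
    LinearMap.flip ((bracketHom B c₁ c₂ p q).compr₂ (Finsupp.lsingle (p + q))))

theorem preBracket_single (B : InvariantForm g) (c₁ c₂ : ℂ) (p q : Exponent n)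
    (e f : Coeff n g) :
    preBracket B c₁ c₂ (Finsupp.single p e) (Finsupp.single q f) =
      Finsupp.single (p + q) (bracketFun B c₁ c₂ p q e f) := by
  simp [preBracket, bracketHom]

theorem single_mem_exactForms (k : Exponent n) (c : ℂ) {e : Coeff n g}
    (he : e = (0, c • cvec k, 0)) :
    (Finsupp.single k e : PreToroidal n g) ∈ exactForms n g := by
  have h : (Finsupp.single k e : PreToroidal n g) =
      c • Finsupp.single k (0, cvec k, 0) := by
    rw [Finsupp.smul_single, he]; simp
  rw [h]
  exact Submodule.smul_mem _ _ (Submodule.subset_span ⟨k, rfl⟩)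

variable (B : InvariantForm g) (c₁ c₂ : ℂ)

theorem preBracket_exact_left :
    exactForms n g ≤ LinearMap.ker ((preBracket B c₁ c₂).compr₂ (exactForms n g).mkQ) := by
  rw [exactForms, Submodule.span_le]
  rintro _ ⟨k, rfl⟩
  rw [SetLike.mem_coe, LinearMap.mem_ker]
  refine Finsupp.lhom_ext fun q f => ?_
  obtain ⟨y, b, w⟩ := f
  simp only [LinearMap.compr₂_apply, LinearMap.zero_apply, Submodule.mkQ_apply,
    Submodule.Quotient.mk_eq_zero, preBracket_single]
  refine single_mem_exactForms _ (-(w ⬝ᵥ cvec k)) ?_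
  simp only [bracketFun, Prod.mk.injEq, zero_lie, zero_dotProduct, map_zero,
    LinearMap.zero_apply, cvec_add]
  refine ⟨by module, by module, by module⟩

theorem preBracket_exact_right :
    exactForms n g ≤ LinearMap.ker ((preBracket B c₁ c₂).compr₂ (exactForms n g).mkQ).flip := by
  rw [exactForms, Submodule.span_le]
  rintro _ ⟨k, rfl⟩
  rw [SetLike.mem_coe, LinearMap.mem_ker]
  refine Finsupp.lhom_ext fun q f => ?_
  obtain ⟨y, b, w⟩ := f
  simp only [LinearMap.flip_apply, LinearMap.compr₂_apply, LinearMap.zero_apply,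
    Submodule.mkQ_apply, Submodule.Quotient.mk_eq_zero, preBracket_single]
  refine single_mem_exactForms _ (w ⬝ᵥ cvec k) ?_
  simp only [bracketFun, Prod.mk.injEq, lie_zero, zero_dotProduct, map_zero, cvec_add]
  refine ⟨by module, by module, by module⟩

variable (n) in
/-- The full toroidal Lie algebra `(g ⊗ A_n) ⊕ (Ω_{A_n} / dA_n) ⊕ Der(A_n)`, with the cocycle
`c₁ φ₁ + c₂ φ₂`. -/
def FullToroidal (_B : InvariantForm g) (_c₁ _c₂ : ℂ) : Type _ :=
  PreToroidal n g ⧸ exactForms n g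

instance : AddCommGroup (FullToroidal n B c₁ c₂) :=
  inferInstanceAs (AddCommGroup (PreToroidal n g ⧸ exactForms n g))

instance : Module ℂ (FullToroidal n B c₁ c₂) :=
  inferInstanceAs (Module ℂ (PreToroidal n g ⧸ exactForms n g))

variable (n) in
/-- The quotient map onto the full toroidal Lie algebra. -/
def FullToroidal.mk : PreToroidal n g →ₗ[ℂ] FullToroidal n B c₁ c₂ :=
  (exactForms n g).mkQ

variable (n) in
/-- The bracket of the full toroidal Lie algebra, as a bilinear map. -/
def FullToroidal.bracket :
    FullToroidal n B c₁ c₂ →ₗ[ℂ] FullToroidal n B c₁ c₂ →ₗ[ℂ] FullToroidal n B c₁ c₂ :=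
  ((exactForms n g).liftQ
    ((exactForms n g).liftQ ((preBracket B c₁ c₂).compr₂ (exactForms n g).mkQ)
      (preBracket_exact_left B c₁ c₂)).flip (by
        intro z hz
        have h := preBracket_exact_right B c₁ c₂ hz
        rw [LinearMap.mem_ker] at h ⊢
        refine LinearMap.ext fun x => ?_
        obtain ⟨y, rfl⟩ := (exactForms n g).mkQ_surjective x
        exact LinearMap.congr_fun h y)).flip

instance : Bracket (FullToroidal n B c₁ c₂) (FullToroidal n B c₁ c₂) :=
  ⟨fun x y => FullToroidal.bracket n B c₁ c₂ x y⟩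

theorem FullToroidal.lie_mk_single (p q : Exponent n) (e f : Coeff n g) :
    ⁅FullToroidal.mk n B c₁ c₂ (Finsupp.single p e),
      FullToroidal.mk n B c₁ c₂ (Finsupp.single q f)⁆ =
    FullToroidal.mk n B c₁ c₂ (Finsupp.single (p + q) (bracketFun B c₁ c₂ p q e f)) := by
  rw [← preBracket_single]
  rfl

variable {B c₁ c₂} in
theorem FullToroidal.induction {motive : FullToroidal n B c₁ c₂ → Prop}
    (zero : motive 0) (add : ∀ x y, motive x → motive y → motive (x + y))
    (single : ∀ p e, motive (FullToroidal.mk n B c₁ c₂ (Finsupp.single p e))) (x) :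
    motive x := by
  obtain ⟨y, rfl⟩ := (exactForms n g).mkQ_surjective x
  induction y using Finsupp.induction_linear with
  | zero => rw [map_zero]; exact zero
  | add y z hy hz => rw [map_add]; exact add _ _ hy hz
  | single p e => exact single p e

theorem FullToroidal.add_lie' (x y z : FullToroidal n B c₁ c₂) :
    ⁅x + y, z⁆ = ⁅x, z⁆ + ⁅y, z⁆ :=
  LinearMap.map_add₂ (FullToroidal.bracket n B c₁ c₂) x y z

theorem FullToroidal.lie_add' (x y z : FullToroidal n B c₁ c₂) :
    ⁅x, y + z⁆ = ⁅x, y⁆ + ⁅x, z⁆ :=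
  map_add (FullToroidal.bracket n B c₁ c₂ x) y z

theorem FullToroidal.zero_lie' (z : FullToroidal n B c₁ c₂) : ⁅(0 : FullToroidal n B c₁ c₂), z⁆ = 0 :=
  LinearMap.map_zero₂ (FullToroidal.bracket n B c₁ c₂) z

theorem FullToroidal.lie_zero' (z : FullToroidal n B c₁ c₂) : ⁅z, (0 : FullToroidal n B c₁ c₂)⁆ = 0 :=
  map_zero (FullToroidal.bracket n B c₁ c₂ z)

theorem FullToroidal.mk_single_eq_zero (k : Exponent n) (c : ℂ) {e : Coeff n g}
    (he : e = (0, c • cvec k, 0)) :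
    FullToroidal.mk n B c₁ c₂ (Finsupp.single k e) = 0 :=
  (Submodule.Quotient.mk_eq_zero _).2 (single_mem_exactForms k c he)

theorem FullToroidal.mk_single_eq (k l : Exponent n) (hkl : k = l) (c : ℂ) {e f : Coeff n g}
    (he : e - f = (0, c • cvec k, 0)) :
    FullToroidal.mk n B c₁ c₂ (Finsupp.single k e) =
      FullToroidal.mk n B c₁ c₂ (Finsupp.single l f) := by
  subst hkl
  rw [← sub_eq_zero, ← map_sub, ← Finsupp.single_sub]
  exact FullToroidal.mk_single_eq_zero B c₁ c₂ k c he

theorem FullToroidal.lie_skew' (x y : FullToroidal n B c₁ c₂) : ⁅x, y⁆ + ⁅y, x⁆ = 0 := by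
  induction x using FullToroidal.induction with
  | zero => simp [FullToroidal.zero_lie', FullToroidal.lie_zero']
  | add x x' hx hx' =>
    rw [FullToroidal.add_lie', FullToroidal.lie_add']
    calc _ = (⁅x, y⁆ + ⁅y, x⁆) + (⁅x', y⁆ + ⁅y, x'⁆) := by abel
      _ = 0 := by rw [hx, hx', add_zero]
  | single p e =>
  induction y using FullToroidal.induction with
  | zero => simp [FullToroidal.zero_lie', FullToroidal.lie_zero']
  | add x x' hx hx' =>
    rw [FullToroidal.add_lie', FullToroidal.lie_add']
    generalize FullToroidal.mk n B c₁ c₂ (Finsupp.single p e) = y at *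
    calc _ = (⁅y, x⁆ + ⁅x, y⁆) + (⁅y, x'⁆ + ⁅x', y⁆) := by abel
      _ = 0 := by rw [hx, hx', add_zero]
  | single q f =>
  obtain ⟨x, a, u⟩ := e
  obtain ⟨y, b, w⟩ := f
  rw [FullToroidal.lie_mk_single, FullToroidal.lie_mk_single, add_comm q p, ← map_add,
    ← Finsupp.single_add]
  refine FullToroidal.mk_single_eq_zero B c₁ c₂ _
    (B.form x y - c₁ * (u ⬝ᵥ cvec q) * (w ⬝ᵥ cvec p)
      - c₂ * (u ⬝ᵥ cvec p) * (w ⬝ᵥ cvec q)) ?_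
  simp only [bracketFun, Prod.mk_add_mk, Prod.mk.injEq, cvec_add]
  rw [B.symm y x, ← lie_skew x y]
  refine ⟨by module, by module, by module⟩

theorem FullToroidal.leibniz' (x y z : FullToroidal n B c₁ c₂) :
    ⁅x, ⁅y, z⁆⁆ = ⁅⁅x, y⁆, z⁆ + ⁅y, ⁅x, z⁆⁆ := by
  induction x using FullToroidal.induction with
  | zero => simp [FullToroidal.zero_lie', FullToroidal.lie_zero']
  | add x x' hx hx' =>
    simp only [FullToroidal.add_lie', FullToroidal.lie_add', hx, hx']; abel
  | single p e =>
  induction y using FullToroidal.induction with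
  | zero => simp [FullToroidal.zero_lie', FullToroidal.lie_zero']
  | add x x' hx hx' =>
    simp only [FullToroidal.add_lie', FullToroidal.lie_add', hx, hx']; abel
  | single q f =>
  induction z using FullToroidal.induction with
  | zero => simp [FullToroidal.lie_zero']
  | add x x' hx hx' =>
    simp only [FullToroidal.lie_add', hx, hx']; abel
  | single r h =>
  obtain ⟨x, a, u⟩ := e
  obtain ⟨y, b, w⟩ := f
  obtain ⟨z, d, v⟩ := h
  simp only [FullToroidal.lie_mk_single]
  rw [show q + (p + r) = p + q + r by abel, ← map_add, ← Finsupp.single_add]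
  refine FullToroidal.mk_single_eq B c₁ c₂ _ _ (by abel)
    (B.form x y * (v ⬝ᵥ cvec p) - c₁ * (u ⬝ᵥ cvec q) * (w ⬝ᵥ cvec p) * (v ⬝ᵥ cvec p)
      - c₂ * (u ⬝ᵥ cvec p) * (w ⬝ᵥ cvec q) * (v ⬝ᵥ cvec p)) ?_
  have h1 : B.form y ⁅x, z⁆ = - B.form ⁅x, y⁆ z := by
    rw [← B.invariant, ← lie_skew y x, map_neg, LinearMap.neg_apply]
  have h2 : B.form x ⁅y, z⁆ = B.form ⁅x, y⁆ z := (B.invariant x y z).symm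
  simp only [bracketFun, Prod.mk_add_mk, Prod.mk_sub_mk, Prod.mk.injEq, cvec_add,
    add_lie, lie_add, sub_lie, lie_sub, smul_lie, lie_smul, map_add, map_sub, map_smul,
    LinearMap.add_apply, LinearMap.sub_apply, LinearMap.smul_apply, smul_eq_mul,
    dotProduct_add, sub_dotProduct, dotProduct_sub, smul_dotProduct,
    dotProduct_smul, h1, h2, B.symm y x]
  refine ⟨?_, ?_, ?_⟩
  · rw [leibniz_lie x y z, ← lie_skew x y]
    module
  · module
  · module

instance : LieRing (FullToroidal n B c₁ c₂) where
  add_lie := FullToroidal.add_lie' B c₁ c₂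
  lie_add := FullToroidal.lie_add' B c₁ c₂
  lie_self x := by
    have h := FullToroidal.lie_skew' B c₁ c₂ x x
    rw [← two_smul ℂ] at h
    exact (smul_eq_zero.1 h).resolve_left two_ne_zero
  leibniz_lie := FullToroidal.leibniz' B c₁ c₂

instance : LieAlgebra ℂ (FullToroidal n B c₁ c₂) where
  lie_smul c x y := map_smul (FullToroidal.bracket n B c₁ c₂ x) c y

namespace FullToroidal

/-- The element `x ⊗ t^k`. -/
def loop (k : Exponent n) (x : g) : FullToroidal n B c₁ c₂ :=
  mk n B c₁ c₂ (Finsupp.single k (x, 0, 0))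

/-- The element `∑ i, a i • t^k K_i` of `Ω_{A_n} / dA_n`. -/
def central (k : Exponent n) (a : Fin n → ℂ) : FullToroidal n B c₁ c₂ :=
  mk n B c₁ c₂ (Finsupp.single k (0, a, 0))

/-- The vector field `D(u, k) = ∑ i, u i • t^k d_i`. -/
def vectorField (k : Exponent n) (u : Fin n → ℂ) : FullToroidal n B c₁ c₂ :=
  mk n B c₁ c₂ (Finsupp.single k (0, 0, u))

end FullToroidal

end FullToroidal

section Multiloop

/-- Commuting automorphisms `σ_1, …, σ_n` of `g`, of finite orders `m_1, …, m_n`, together with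
primitive `m_i`-th roots of unity `ζ_i`. -/
structure AutTuple (n : ℕ) (g : Type*) [LieRing g] [LieAlgebra ℂ g] where
  σ : Fin n → (g ≃ₗ⁅ℂ⁆ g)
  m : Fin n → ℕ
  m_pos : ∀ i, 0 < m i
  order_eq : ∀ i, orderOf (σ i).toLinearEquiv = m i
  commute : ∀ i j x, σ i (σ j x) = σ j (σ i x)
  ζ : Fin n → ℂ
  primitive : ∀ i, IsPrimitiveRoot (ζ i) (m i)

variable {n : ℕ} {g : Type*} [LieRing g] [LieAlgebra ℂ g]

namespace AutTuple

variable (S : AutTuple n g)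

/-- The lattice `Γ = m_1 ℤ ⊕ ⋯ ⊕ m_n ℤ`. -/
def Γ : AddSubgroup (Exponent n) where
  carrier := {k | ∀ i, (S.m i : ℤ) ∣ k i}
  zero_mem' _ := dvd_zero _
  add_mem' hk hl i := dvd_add (hk i) (hl i)
  neg_mem' hk i := (dvd_neg).2 (hk i)

theorem ζ_ne_zero (i : Fin n) : S.ζ i ≠ 0 :=
  (S.primitive i).ne_zero (S.m_pos i).ne'

/-- The simultaneous eigenspace `g(k̄) = {x | σ_i x = ζ_i ^ k_i x for all i}`. -/
def eigenpart (k : Exponent n) : Submodule ℂ g where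
  carrier := {x | ∀ i, S.σ i x = (S.ζ i) ^ (k i) • x}
  zero_mem' i := by simp
  add_mem' hx hy i := by rw [map_add, hx i, hy i, smul_add]
  smul_mem' c x hx i := by rw [map_smul, hx i, smul_comm]

theorem lie_mem_eigenpart {k l : Exponent n} {x y : g} (hx : x ∈ S.eigenpart k)
    (hy : y ∈ S.eigenpart l) : ⁅x, y⁆ ∈ S.eigenpart (k + l) := by
  intro i
  rw [LieEquiv.map_lie, hx i, hy i, smul_lie, lie_smul, smul_smul, Pi.add_apply,
    zpow_add₀ (S.ζ_ne_zero i)]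

theorem eigenpart_add_of_mem {k r : Exponent n} (hr : r ∈ S.Γ) {x : g}
    (hx : x ∈ S.eigenpart k) : x ∈ S.eigenpart (k + r) := by
  intro i
  rw [hx i, Pi.add_apply, zpow_add₀ (S.ζ_ne_zero i),
    ((S.primitive i).zpow_eq_one_iff_dvd (r i)).2 (hr i), mul_one]

/-- The subalgebra `g(0̄)` of fixed points. -/
def fixed : LieSubalgebra ℂ g where
  toSubmodule := S.eigenpart 0
  lie_mem' hx hy := by simpa using S.lie_mem_eigenpart hx hy

/-- `g(k̄)` as a `g(0̄)`-module. -/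
def gradedPart (k : Exponent n) : LieSubmodule ℂ S.fixed g where
  toSubmodule := S.eigenpart k
  lie_mem {x y} hy := by simpa using S.lie_mem_eigenpart x.2 hy

section Cartan

variable (H₀ : LieSubalgebra ℂ S.fixed)

/-- `g(k̄, α) = {x ∈ g(k̄) | [h, x] = α(h) x for all h ∈ h(0̄)}`. -/
def rootPart (k : Exponent n) (α : Module.Dual ℂ H₀) : Submodule ℂ g where
  carrier := {x | x ∈ S.eigenpart k ∧ ∀ h : H₀, ⁅((h : S.fixed) : g), x⁆ = α h • x}
  zero_mem' := ⟨zero_mem _, fun h => by simp⟩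
  add_mem' hx hy := ⟨add_mem hx.1 hy.1, fun h => by rw [lie_add, hx.2 h, hy.2 h, smul_add]⟩
  smul_mem' c x hx := ⟨Submodule.smul_mem _ c hx.1, fun h => by
    rw [lie_smul, hx.2 h, smul_comm]⟩

/-- The weights relative to `h(0̄)` of a `g(0̄)`-submodule `W` of `g`. -/
def weights (W : LieSubmodule ℂ S.fixed g) : Set (Module.Dual ℂ H₀) :=
  {α | ∃ x ∈ W, x ≠ 0 ∧ ∀ h : H₀, ⁅((h : S.fixed) : g), x⁆ = α h • x}

/-- The roots `Δ₀^×` of `g(0̄)` relative to `h(0̄)`. -/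
def roots : Set (Module.Dual ℂ H₀) :=
  {α | α ≠ 0 ∧ α ∈ S.weights H₀ (S.gradedPart 0)}

end Cartan

end AutTuple

/-- `R` is a root system of type `B_l`, `l ≥ 1` (with `B_1 = A_1`), whose short roots are
the vectors `± e i`. -/
def IsTypeB {E : Type*} [AddCommGroup E] [Module ℂ E] (R : Set E) {l : ℕ} (e : Fin l → E) :
    Prop :=
  1 ≤ l ∧ LinearIndependent ℂ e ∧
    R = {v | (∃ i, v = e i ∨ v = - e i) ∨
      ∃ i j, i ≠ j ∧ (v = e i + e j ∨ v = e i - e j ∨ v = - e i - e j)}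

/-- The set `Δ_en = {0} ∪ Δ^×_en` attached to `Δ^× = R`, where `Δ^×_en = Δ^× ∪ 2 Δ^×_sh` if
`R` is of type `B_l`, and `Δ^×_en = Δ^×` otherwise. -/
def enlarged {E : Type*} [AddCommGroup E] [Module ℂ E] (R : Set E) : Set E :=
  {v | v = 0 ∨ v ∈ R ∨
    ∃ (l : ℕ) (e : Fin l → E), IsTypeB R e ∧ ∃ i, v = (2 : ℂ) • e i ∨ v = - (2 : ℂ) • e i}

namespace AutTuple

variable (S : AutTuple n g) (H₀ : LieSubalgebra ℂ S.fixed)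

/-- Condition (M): `W` is irreducible of dimension greater than `1`, and its weights relative
to `h(0̄)` lie in `Δ_{0,en}`. -/
def ConditionM (W : LieSubmodule ℂ S.fixed g) : Prop :=
  LieModule.IsIrreducible ℂ S.fixed W ∧ 1 < Module.finrank ℂ W ∧
    S.weights H₀ W ⊆ enlarged (S.roots H₀)

/-- The multiloop algebra `⊕_k g(k̄) ⊗ t^k` is a Lie torus. -/
structure IsLieTorus : Prop where
  simple : LieAlgebra.IsSimple ℂ S.fixed
  decomposition : ∀ k, k ∉ S.Γ → ∃ U W : LieSubmodule ℂ S.fixed g,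
    U ⊔ W = S.gradedPart k ∧ Disjoint U W ∧
    LieModule.IsTrivial S.fixed U ∧ (W = ⊥ ∨ S.ConditionM H₀ W)
  card_eq : Nat.card (Subgroup.closure (Set.range fun i => (S.σ i).toLinearEquiv)) = ∏ i, S.m i

end AutTuple

end Multiloop

section Invariance

variable {g : Type*} [LieRing g] [LieAlgebra ℂ g] [FiniteDimensional ℂ g]
  [LieAlgebra.IsSimple ℂ g]

theorem InvariantForm.eq_smul_killingForm (B : InvariantForm g) :
    ∃ c : ℂ, ∀ x y, B.form x y = c * killingForm ℂ g x y := by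
  have hK : (killingForm ℂ g).Nondegenerate := LieAlgebra.IsKilling.killingForm_nondegenerate ℂ g
  have : Nontrivial g := LieAlgebra.IsSimple.nontrivial ℂ g
  let T : Module.End ℂ g := (LinearMap.BilinForm.toDual (killingForm ℂ g) hK).symm ∘ₗ B.form
  have hT : ∀ x y, killingForm ℂ g (T x) y = B.form x y := fun x y =>
    LinearMap.BilinForm.apply_toDual_symm_apply (hB := hK) (B.form x) y
  obtain ⟨c, hc⟩ := Module.End.exists_eigenvalue T
  let I : LieIdeal ℂ g :=
    { (Module.End.eigenspace T c) with
      lie_mem := by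
        intro x y hy
        have hy' : T y = c • y := Module.End.mem_eigenspace_iff.1 hy
        refine Module.End.mem_eigenspace_iff.2 ?_
        refine (LinearMap.BilinForm.toDual (killingForm ℂ g) hK).injective ?_
        ext z
        simp only [LinearMap.BilinForm.toDual_def]
        rw [hT, ← lie_skew x y, map_neg, LinearMap.neg_apply, B.invariant, ← hT, hy', map_smul,
          LinearMap.smul_apply, smul_neg, map_neg, map_smul, LinearMap.neg_apply,
          LinearMap.smul_apply, LieModule.traceForm_apply_lie_apply] }
  have hI : I = ⊤ := (LieAlgebra.IsSimple.eq_bot_or_eq_top I).resolve_left fun h => hc <| by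
    have h' := congrArg LieSubmodule.toSubmodule h
    simpa [I] using h'
  refine ⟨c, fun x y => ?_⟩
  have hx : x ∈ I := hI ▸ LieSubmodule.mem_top x
  have hx' : T x = c • x := Module.End.mem_eigenspace_iff.1 hx
  rw [← hT, hx', map_smul, LinearMap.smul_apply, smul_eq_mul]

theorem InvariantForm.map_equiv (B : InvariantForm g) (e : g ≃ₗ⁅ℂ⁆ g) (x y : g) :
    B.form (e x) (e y) = B.form x y := by
  obtain ⟨c, hc⟩ := B.eq_smul_killingForm
  rw [hc, hc, LieAlgebra.killingForm_of_equiv_apply]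

variable {n : ℕ}

theorem AutTuple.add_mem_Γ (S : AutTuple n g) (B : InvariantForm g) {k l : Exponent n} {x y : g}
    (hx : x ∈ S.eigenpart k) (hy : y ∈ S.eigenpart l) (h : B.form x y ≠ 0) : k + l ∈ S.Γ := by
  intro i
  have h1 := B.map_equiv (S.σ i) x y
  rw [hx i, hy i, map_smul, map_smul, LinearMap.smul_apply, smul_smul, smul_eq_mul] at h1
  have h2 := (mul_eq_right₀ h).1 h1
  rw [← zpow_add₀ (S.ζ_ne_zero i), ← Pi.add_apply, add_comm] at h2
  exact ((S.primitive i).zpow_eq_one_iff_dvd _).1 h2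

end Invariance

section Twisted

open FullToroidal

variable {n : ℕ} {g : Type*} [LieRing g] [LieAlgebra ℂ g]
variable (S : AutTuple n g) (B : InvariantForm g) (c₁ c₂ : ℂ)

/-- The elements `x ⊗ t^k` with `k ∈ ℤⁿ` and `x ∈ g(k̄)`. -/
def loopGens : Set (FullToroidal n B c₁ c₂) :=
  {y | ∃ k, ∃ x ∈ S.eigenpart k, y = loop B c₁ c₂ k x}

/-- The elements `∑ i, a i • t^r K_i` with `r ∈ Γ`. -/
def centralGens : Set (FullToroidal n B c₁ c₂) :=
  {y | ∃ r ∈ S.Γ, ∃ a, y = central B c₁ c₂ r a}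

/-- The elements `D(u, r)` with `r ∈ Γ`, `u ∈ ℂⁿ` and `(u|r) = 0`. -/
def divFieldGens : Set (FullToroidal n B c₁ c₂) :=
  {y | ∃ r ∈ S.Γ, ∃ u, u ⬝ᵥ cvec r = 0 ∧ y = vectorField B c₁ c₂ r u}

/-- The multiloop algebra `LT = ⊕_k g(k̄) ⊗ t^k`. -/
def loopPart : Submodule ℂ (FullToroidal n B c₁ c₂) := Submodule.span ℂ (loopGens S B c₁ c₂)

/-- The space `Ω_{A_n(m)} / d_{A_n(m)}`. -/
def centralPart : Submodule ℂ (FullToroidal n B c₁ c₂) :=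
  Submodule.span ℂ (centralGens S B c₁ c₂)

/-- The space `S_n(m)` of divergence zero vector fields. -/
def divFieldPart : Submodule ℂ (FullToroidal n B c₁ c₂) := Submodule.span ℂ (divFieldGens S B c₁ c₂)

theorem sup_eq_span : loopPart S B c₁ c₂ ⊔ centralPart S B c₁ c₂ ⊔ divFieldPart S B c₁ c₂ =
    Submodule.span ℂ (loopGens S B c₁ c₂ ∪ centralGens S B c₁ c₂ ∪ divFieldGens S B c₁ c₂) := by
  rw [Submodule.span_union, Submodule.span_union]
  rfl

variable [FiniteDimensional ℂ g] [LieAlgebra.IsSimple ℂ g]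

theorem lie_gens_mem {x y : FullToroidal n B c₁ c₂}
    (hx : x ∈ loopGens S B c₁ c₂ ∪ centralGens S B c₁ c₂ ∪ divFieldGens S B c₁ c₂)
    (hy : y ∈ loopGens S B c₁ c₂ ∪ centralGens S B c₁ c₂ ∪ divFieldGens S B c₁ c₂) :
    ⁅x, y⁆ ∈ loopPart S B c₁ c₂ ⊔ centralPart S B c₁ c₂ ⊔ divFieldPart S B c₁ c₂ := by
  have key : ∀ k z a u, z ∈ S.eigenpart k → (a ≠ 0 → k ∈ S.Γ) → (u ≠ 0 → k ∈ S.Γ) →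
      u ⬝ᵥ cvec k = 0 →
      mk n B c₁ c₂ (Finsupp.single k (z, a, u)) ∈
        loopPart S B c₁ c₂ ⊔ centralPart S B c₁ c₂ ⊔ divFieldPart S B c₁ c₂ := by
    intro k z a u hz ha hu huk
    have e : mk n B c₁ c₂ (Finsupp.single k (z, a, u)) =
        loop B c₁ c₂ k z + central B c₁ c₂ k a + vectorField B c₁ c₂ k u := by
      simp only [loop, central, vectorField, ← map_add, ← Finsupp.single_add, Prod.mk_add_mk,
        add_zero, zero_add]
    rw [e]
    refine Submodule.add_mem_sup (Submodule.add_mem_sup ?_ ?_) ?_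
    · exact Submodule.subset_span ⟨k, z, hz, rfl⟩
    · by_cases h : a = 0
      · subst h
        have : central B c₁ c₂ k 0 = 0 := by
          unfold central
          exact mk_single_eq_zero B c₁ c₂ k 0 (by simp)
        rw [this]; exact zero_mem _
      · exact Submodule.subset_span ⟨k, ha h, a, rfl⟩
    · by_cases h : u = 0
      · subst h
        have : vectorField B c₁ c₂ k 0 = 0 := by
          unfold vectorField
          exact mk_single_eq_zero B c₁ c₂ k 0 (by simp)
        rw [this]; exact zero_mem _
      · exact Submodule.subset_span ⟨k, hu h, u, huk, rfl⟩
  rcases hx with (⟨p, x, hx, rfl⟩ | ⟨p, hp, a, rfl⟩) | ⟨p, hp, u, hu, rfl⟩ <;>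
  rcases hy with (⟨q, y, hy, rfl⟩ | ⟨q, hq, b, rfl⟩) | ⟨q, hq, w, hw, rfl⟩ <;>
  simp only [loop, central, vectorField, lie_mk_single, bracketFun] <;>
  refine key _ _ _ _ ?_ ?_ ?_ ?_
  · simpa using S.lie_mem_eigenpart hx hy
  · intro h
    refine S.add_mem_Γ B hx hy fun h0 => h ?_
    simp [h0]
  · simp
  · simp
  · simp
  · simp
  · simp
  · simp
  · simpa using Submodule.smul_mem _ (w ⬝ᵥ cvec p) (S.eigenpart_add_of_mem hq hx)
  · simp
  · simp
  · simp
  · simp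
  · simp
  · simp
  · simp
  · simp
  · simp
  · simp
  · simp
  · simp
  · exact fun _ => add_mem hp hq
  · exact fun _ => add_mem hp hq
  · simp
  · rw [add_comm p q]
    simpa using Submodule.smul_mem _ (u ⬝ᵥ cvec q) (S.eigenpart_add_of_mem hp hy)
  · simp
  · simp
  · simp
  · simp
  · exact fun _ => add_mem hp hq
  · exact fun _ => add_mem hp hq
  · simp
  · simp
  · exact fun _ => add_mem hp hq
  · exact fun _ => add_mem hp hq
  · simp only [cvec_add, sub_dotProduct, smul_dotProduct, dotProduct_add, hu, hw,
      smul_eq_mul]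
    ring

/-- The twisted toroidal extended affine Lie algebra
`τ = LT ⊕ Ω_{A_n(m)} / d_{A_n(m)} ⊕ S_n(m)`. -/
def twisted : LieSubalgebra ℂ (FullToroidal n B c₁ c₂) where
  toSubmodule := loopPart S B c₁ c₂ ⊔ centralPart S B c₁ c₂ ⊔ divFieldPart S B c₁ c₂
  lie_mem' {x y} hx hy := by
    simp only [AddSubsemigroup.mem_carrier, AddSubmonoid.mem_toSubsemigroup,
      Submodule.mem_toAddSubmonoid] at hx hy ⊢
    rw [sup_eq_span] at hx hy
    induction hx using Submodule.span_induction with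
    | zero => rw [zero_lie]; exact zero_mem _
    | add a b _ _ ha hb => rw [add_lie]; exact add_mem ha hb
    | smul c a _ ha => rw [smul_lie]; exact Submodule.smul_mem _ c ha
    | mem a ha =>
    induction hy using Submodule.span_induction with
    | zero => rw [lie_zero]; exact zero_mem _
    | add b b' _ _ hb hb' => rw [lie_add]; exact add_mem hb hb'
    | smul c b _ hb => rw [lie_smul]; exact Submodule.smul_mem _ c hb
    | mem b hb => exact lie_gens_mem S B c₁ c₂ ha hb

variable {S c₁ c₂}

/-- `x ⊗ t^k`, for `x ∈ g(k̄)`, as an element of `τ`. -/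
def loopElt (k : Exponent n) (x : S.eigenpart k) : twisted S B c₁ c₂ :=
  ⟨loop B c₁ c₂ k x, Submodule.mem_sup_left (Submodule.mem_sup_left
    (Submodule.subset_span ⟨k, x, x.2, rfl⟩))⟩

variable (S c₁ c₂)

/-- The zero degree central element `K_i` of `τ`. -/
def centralK (i : Fin n) : twisted S B c₁ c₂ :=
  ⟨central B c₁ c₂ 0 (Pi.single i 1), Submodule.mem_sup_left (Submodule.mem_sup_right
    (Submodule.subset_span ⟨0, zero_mem _, _, rfl⟩))⟩

/-- The degree derivation `d_i` of `τ`. -/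
def degreeD (i : Fin n) : twisted S B c₁ c₂ :=
  ⟨vectorField B c₁ c₂ 0 (Pi.single i 1), Submodule.mem_sup_right
    (Submodule.subset_span ⟨0, zero_mem _, _, by simp [cvec_zero], rfl⟩)⟩

variable {S} (H₀ : LieSubalgebra ℂ S.fixed)

/-- The Cartan subalgebra `H = h(0̄) ⊕ ∑ ℂ K_i ⊕ ∑ ℂ d_i` of `τ`. -/
def cartan : Submodule ℂ (twisted S B c₁ c₂) :=
  Submodule.span ℂ
    (Set.range (fun h : H₀ => loopElt (S := S) B 0 ⟨((h : S.fixed) : g), (h : S.fixed).2⟩) ∪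
      Set.range (centralK S B c₁ c₂) ∪ Set.range (degreeD S B c₁ c₂))

section Modules

variable {B c₁ c₂}
variable (V : Type*) [AddCommGroup V] [Module ℂ V] [LieRingModule (twisted S B c₁ c₂) V]
  [LieModule ℂ (twisted S B c₁ c₂) V]

/-- The weight space `V_lam = {v | h v = lam(h) v for all h ∈ H}`. -/
def weightSpace (lam : Module.Dual ℂ (cartan B c₁ c₂ H₀)) : Submodule ℂ V where
  carrier := {v | ∀ h : cartan B c₁ c₂ H₀, ⁅(h : twisted S B c₁ c₂), v⁆ = lam h • v}
  zero_mem' h := by simp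
  add_mem' hv hw h := by rw [lie_add, hv h, hw h, smul_add]
  smul_mem' c v hv h := by rw [lie_smul, hv h, smul_comm]

variable (B c₁ c₂)

open Classical in
/-- Integrable `τ`-modules: `V` is the direct sum of its weight spaces, these are
finite-dimensional, and all real root vectors act locally nilpotently. -/
structure IsIntegrable : Prop where
  isInternal : DirectSum.IsInternal fun lam : Module.Dual ℂ (cartan B c₁ c₂ H₀) => weightSpace H₀ V lam
  finite_dimensional : ∀ lam : Module.Dual ℂ (cartan B c₁ c₂ H₀), FiniteDimensional ℂ (weightSpace H₀ V lam)
  locally_nilpotent : ∀ (k : Exponent n) (α : Module.Dual ℂ H₀), α ∈ enlarged (S.roots H₀) →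
    α ≠ 0 → ∀ (x : g) (hx : x ∈ S.rootPart H₀ k α) (v : V),
      ∃ N : ℕ, ((LieModule.toEnd ℂ (twisted S B c₁ c₂) V (loopElt B k ⟨x, hx.1⟩)) ^ N) v = 0

end Modules

end Twisted

end ToroidalEALA

end

/-!
Since `Ω_{A_n(m)} / d_{A_n(m)}` is an ideal of `τ` (`lie_mem_centralPart`), the vectors it kills form
a submodule of `V`, and it suffices to find one nonzero such vector
(`exists_central_null_vector`). A single `sl₂`-triple is enough for this. Take a root `α` of `g(0̄)` and
`e`, `f`, `h` in `g(0̄)` with `(e|f) ≠ 0` (`AutTuple.exists_sl2Triple`), and for `p, r ∈ Γ` let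
`X p`, `Y p`, `A p` be the actions of `e ⊗ t^p`, `f ⊗ t^p`, `h ⊗ t^p` and let `Z r p` be that of
`(e|f) ∑ i, p_i t^r K_i`. Then `[X p, Y q] = A (p + q) + Z (p + q) p` and
`[A p, Y q] = -2 Y (p + q)`; as the `K_i` act by zero, `X p`, `Y (-p)`, `A 0` is an `sl₂`-triple for
each `p`. Fix a weight `λ` of `V` and consider the weight spaces `W k P` of weight `λ + k α` shifted by
the degree `P ∈ Γ`.

* The weights `k` are bounded above, uniformly in `P` (`exists_weight_bound`). In degree `0` this
  holds because an integrable `sl₂`-module with finite-dimensional weight spaces in one string has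
  bounded weights; and if `W k P` has positive weight, then `Y (-P)` embeds it in `W (k - 1) 0`. By
  symmetry the weights are bounded below.
* On the sum `M` of the `W k P` with the highest possible `k`, all `X p` vanish, the `A p` and `Z r p`
  act, and any product of `N` operators `Y q` vanishes, for some `N`. Applying `X (t p) ^ N` to
  `Y (r₁ - t p) ⋯ Y (r_N - t p) v = 0` gives a polynomial in `t` with leading coefficient
  `N! Z r₁ p ⋯ Z r_N p v` (`IsLoopTriple.hasLeading`), so any product of `N` operators `Z r p` with the
  same `p` kills `M`.
* The `Z r p` commute, and for fixed `r` they are determined by finitely many `p`, generators of `Γ`.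
  Hence they have a common null vector in `M` (`exists_common_kernel`), which is killed by all
  `t^r K_i`.
-/

namespace ToroidalEALA

/-! ### Weights of integrable `sl₂`-modules -/

section SlTwo

variable {V : Type*} [AddCommGroup V] [Module ℂ V]

/-- On a vector of weight `c` with positive real part, raising after lowering is injective as soon
as the raising operator is locally nilpotent: if `X Y v = 0`, then
`Y X (X ^ i v) = -(i + 1) (c + i) X ^ i v`, so that no power of `X` could kill `v`. -/
theorem raise_lower_ne_zero {X Y H : Module.End ℂ V}
    (hXY : ∀ v, X (Y v) = Y (X v) + H v) (hHX : ∀ v, H (X v) = X (H v) + (2 : ℂ) • X v)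
    (hX : ∀ v, ∃ N, (X ^ N) v = 0) {c : ℂ} (hc : 0 < c.re) {v : V} (hv : v ≠ 0)
    (hHv : H v = c • v) : X (Y v) ≠ 0 := by
  intro h0
  have hH : ∀ i : ℕ, H ((X ^ i) v) = (c + 2 * i) • (X ^ i) v := by
    intro i
    induction i with
    | zero => simpa using hHv
    | succ i ih =>
      rw [pow_succ', Module.End.mul_apply, hHX, ih, map_smul]
      push_cast
      module
  have hYX : ∀ i : ℕ, Y (X ((X ^ i) v)) = (-((i + 1) * (c + i))) • (X ^ i) v := by
    intro i
    induction i with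
    | zero =>
      have h1 := hXY v
      rw [h0, hHv] at h1
      simpa using eq_neg_of_add_eq_zero_left h1.symm
    | succ i ih =>
      have h1 := hXY (X ((X ^ i) v))
      rw [ih, map_smul] at h1
      have h2 := hH (i + 1)
      rw [pow_succ', Module.End.mul_apply] at h2 ⊢
      rw [h2] at h1
      rw [← sub_eq_iff_eq_add.2 h1]
      push_cast
      module
  have hne : ∀ i : ℕ, (X ^ i) v ≠ 0 := by
    intro i
    induction i with
    | zero => simpa using hv
    | succ i ih =>
      intro h
      have h1 := hYX i
      rw [pow_succ', Module.End.mul_apply] at h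
      rw [h, map_zero, eq_comm, smul_eq_zero] at h1
      rcases h1 with h1 | h1
      · rw [neg_eq_zero, mul_eq_zero] at h1
        have h3 : (0 : ℝ) ≤ i := i.cast_nonneg
        rcases h1 with h1 | h1
        · exact Nat.cast_add_one_ne_zero i h1
        · have := congrArg Complex.re h1
          simp at this
          linarith
      · exact ih h1
  obtain ⟨N, hN⟩ := hX v
  exact hne N hN

variable {G : Type*} [AddCommGroup G]

/-- Let `X p`, `Y (-p)`, `H` satisfy the `sl₂`-relations for every `p`, with `X p` locally nilpotent of
degree `p`, on a `G`-graded space with weights in a single string `c + 2 ℤ` and finite-dimensional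
weight spaces in degree `0`. Then the weights are bounded above, by the same bound in all degrees. In degree `0` the dimensions decrease along the positive weights, hence
stabilise, and then the lowering operator is bijective, which forces these weight spaces to vanish;
a positive weight space of degree `P` embeds in one of degree `0`, as `Y (-P)` is injective on
it. -/
theorem exists_weight_bound {X Y : G → Module.End ℂ V} {H : Module.End ℂ V}
    (hXY : ∀ p v, X p (Y (-p) v) = Y (-p) (X p v) + H v)
    (hHX : ∀ p v, H (X p v) = X p (H v) + (2 : ℂ) • X p v)
    (hX : ∀ p v, ∃ N, (X p ^ N) v = 0)
    {W : ℤ → G → Submodule ℂ V} (hfin : ∀ k, FiniteDimensional ℂ (W k 0)) {c : ℂ}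
    (hH : ∀ k P, ∀ v ∈ W k P, H v = (c + 2 * k) • v)
    (hXW : ∀ k P p, ∀ v ∈ W k P, X p v ∈ W (k + 1) (P + p))
    (hYW : ∀ k P p, ∀ v ∈ W k P, Y p v ∈ W (k - 1) (P + p)) :
    ∃ K : ℤ, ∀ k, K ≤ k → ∀ P, ∀ v ∈ W k P, v = 0 := by
  obtain ⟨k₀, hk₀⟩ : ∃ k₀ : ℤ, ∀ k, k₀ ≤ k → 0 < (c + 2 * k : ℂ).re := by
    obtain ⟨m, hm⟩ := exists_nat_gt (-c.re)
    refine ⟨m, fun k hk => ?_⟩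
    have h1 : (m : ℝ) ≤ k := by exact_mod_cast hk
    have h2 : (0 : ℝ) ≤ m := m.cast_nonneg
    simp
    linarith
  have hpos : ∀ k, k₀ ≤ k → ∀ P p, ∀ v ∈ W k P, v ≠ 0 → X p (Y (-p) v) ≠ 0 :=
    fun k hk P p v hv hv0 => raise_lower_ne_zero (hXY p) (hHX p) (hX p) (hk₀ k hk) hv0 (hH k P v hv)
  have hpos0 : ∀ k, k₀ ≤ k → ∀ v ∈ W k 0, X 0 (Y 0 v) = 0 → v = 0 := fun k hk v hv h => by
    by_contra hv0
    exact hpos k hk 0 0 v hv hv0 (by rwa [neg_zero])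
  -- the lowering operator from weight `k₀ + j + 1` to weight `k₀ + j` in degree `0`
  have hmaps : ∀ j : ℕ, ∀ v ∈ W (k₀ + (j + 1 : ℕ)) 0, Y 0 v ∈ W (k₀ + j) 0 := by
    intro j v hv
    have := hYW _ _ 0 v hv
    rw [add_zero] at this
    convert this using 2
    push_cast
    ring
  let T : ∀ j : ℕ, W (k₀ + (j + 1 : ℕ)) 0 →ₗ[ℂ] W (k₀ + j) 0 := fun j => (Y 0).restrict (hmaps j)
  have hTinj : ∀ j, Function.Injective (T j) := fun j => by
    rw [← LinearMap.ker_eq_bot, LinearMap.ker_eq_bot']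
    intro v hv
    have hv' : Y 0 (v : V) = 0 := congrArg Subtype.val hv
    exact Subtype.ext (hpos0 _ (by omega) v v.2 (by rw [hv', map_zero]))
  let a : ℕ → ℕ := fun j => Module.finrank ℂ (W (k₀ + j) 0)
  have ha : Antitone a := antitone_nat_of_succ_le fun j =>
    LinearMap.finrank_le_finrank_of_injective (hTinj j)
  obtain ⟨J, hJ⟩ : ∃ J, ∀ j, a J ≤ a j := ⟨Function.argmin a, fun j => Function.argmin_le a j⟩
  have hTsurj : ∀ j, J ≤ j → Function.Surjective (T j) := fun j hj =>
    ((T j).injective_iff_surjective_of_finrank_eq_finrank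
      (le_antisymm (ha j.le_succ) ((ha hj).trans (hJ _)))).1 (hTinj j)
  have hXinj : ∀ j : ℕ, J ≤ j → ∀ v ∈ W (k₀ + j) 0, X 0 v = 0 → v = 0 := by
    intro j hj v hv h
    obtain ⟨w, hw⟩ := hTsurj j hj ⟨v, hv⟩
    have hw' : Y 0 (w : V) = v := congrArg Subtype.val hw
    rw [← hw', hpos0 _ (by omega) w w.2 (by rw [hw', h]), map_zero]
  have hzero : ∀ j : ℕ, J ≤ j → ∀ v ∈ W (k₀ + j) 0, v = 0 := by
    intro j hj v hv
    by_contra hv0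
    have hpow : ∀ i : ℕ, (X 0 ^ i) v ∈ W (k₀ + (j + i : ℕ)) 0 ∧ (X 0 ^ i) v ≠ 0 := by
      intro i
      induction i with
      | zero => exact ⟨by simpa using hv, by simpa using hv0⟩
      | succ i ih =>
        rw [pow_succ', Module.End.mul_apply]
        refine ⟨?_, fun h => ih.2 (hXinj _ (by omega) _ ih.1 h)⟩
        have := hXW _ _ 0 _ ih.1
        rw [add_zero] at this
        convert this using 2
        push_cast
        ring
    obtain ⟨N, hN⟩ := hX 0 v
    exact (hpow N).2 hN
  refine ⟨k₀ + J + 1, fun k hk P v hv => ?_⟩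
  by_contra hv0
  refine hpos k (by omega) P P v hv hv0 ?_
  have h1 := hYW _ _ (-P) v hv
  rw [add_neg_cancel, show k - 1 = k₀ + ((k - 1 - k₀).toNat : ℕ) by omega] at h1
  rw [hzero _ (by omega) _ h1, map_zero]

end SlTwo

/-! ### Vector-valued functions with polynomial coordinates -/

section Leading

variable {V : Type*} [AddCommGroup V] [Module ℂ V]

/-- `φ : ℕ → V` is polynomial of degree at most `j`, with coefficient `u` in degree `j`, when tested
against linear functionals. -/
def HasLeading (j : ℕ) (φ : ℕ → V) (u : V) : Prop :=
  ∀ f : Module.Dual ℂ V, ∃ P : Polynomial ℂ, P.natDegree ≤ j ∧ P.coeff j = f u ∧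
    ∀ t : ℕ, P.eval (t : ℂ) = f (φ t)

namespace HasLeading

variable {j : ℕ} {φ ψ : ℕ → V} {u w : V}

theorem add (h : HasLeading j φ u) (h' : HasLeading j ψ w) :
    HasLeading j (fun t => φ t + ψ t) (u + w) := fun f => by
  obtain ⟨P, h1, h2, h3⟩ := h f
  obtain ⟨Q, k1, k2, k3⟩ := h' f
  exact ⟨P + Q, Polynomial.natDegree_add_le_of_degree_le h1 k1, by simp [h2, k2],
    fun t => by simp [h3, k3]⟩

theorem smul (c : ℂ) (h : HasLeading j φ u) : HasLeading j (fun t => c • φ t) (c • u) := fun f => by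
  obtain ⟨P, h1, h2, h3⟩ := h f
  exact ⟨c • P, (Polynomial.natDegree_smul_le c P).trans h1, by simp [h2], fun t => by simp [h3]⟩

theorem natCast_smul (h : HasLeading j φ u) :
    HasLeading (j + 1) (fun t => (t : ℂ) • φ t) u := fun f => by
  obtain ⟨P, h1, h2, h3⟩ := h f
  refine ⟨Polynomial.X * P, ?_, by simp [h2], fun t => by simp [h3]⟩
  refine Polynomial.natDegree_mul_le.trans ?_
  have := Polynomial.natDegree_X_le (R := ℂ)
  omega

theorem succ_zero (h : HasLeading j φ u) : HasLeading (j + 1) φ 0 := fun f => by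
  obtain ⟨P, h1, _, h3⟩ := h f
  exact ⟨P, by omega, by rw [map_zero, Polynomial.coeff_eq_zero_of_natDegree_lt (by omega)], h3⟩

theorem eq_zero (h : HasLeading j (fun _ => 0) u) : u = 0 := by
  rw [← Module.forall_dual_apply_eq_zero_iff ℂ]
  intro f
  obtain ⟨P, _, h2, h3⟩ := h f
  have hP : P = 0 := by
    refine Polynomial.eq_zero_of_infinite_isRoot P
      ((Set.infinite_range_of_injective (Nat.cast_injective (R := ℂ))).mono ?_)
    rintro _ ⟨t, rfl⟩
    simpa using h3 t
  rw [← h2, hP, Polynomial.coeff_zero]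

end HasLeading

end Leading

/-! ### Products of central elements on highest weight spaces -/

section LoopTriple

variable {G V : Type*} [AddCommGroup G] [AddCommGroup V] [Module ℂ V]

/-- The relations among operators `X p`, `Y p`, `A p`, `Z r p` representing
`e ⊗ t^p`, `f ⊗ t^p`, `h ⊗ t^p` for an `sl₂`-triple `(h, e, f)`, and the multiple
`(e|f) ∑ i, p_i t^r K_i`, in a central extension of the loop algebra of `sl₂`. -/
structure IsLoopTriple (X Y A : G → Module.End ℂ V) (Z : G → G → Module.End ℂ V) : Prop where
  raise_mul_lower : ∀ p q, X p * Y q = Y q * X p + (A (p + q) + Z (p + q) p)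
  cartan_mul_lower : ∀ p q, A p * Y q = Y q * A p - (2 : ℂ) • Y (p + q)
  commute_lower : ∀ r p q, Commute (Z r p) (Y q)
  commute_central : ∀ r p s q, Commute (Z r p) (Z s q)
  central_nsmul : ∀ r (t : ℕ) p, Z r (t • p) = (t : ℂ) • Z r p

namespace IsLoopTriple

variable {X Y A : G → Module.End ℂ V} {Z : G → G → Module.End ℂ V}

/-- For a highest weight vector `v`, the vector `X (t p) ^ j Y (r₁ - t p) ⋯ Y (r_j - t p) v` is
polynomial of degree at most `j` in `t`, with leading coefficient `j! Z r₁ p ⋯ Z r_j p v`: moving an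
`X (t p)` to the right past `Y (r - t p)` produces `A r + t Z r p`, and moving `A r` further to the
right only merges it with another `Y (r' - t p)` into `Y (r + r' - t p)`. -/
theorem hasLeading (h : IsLoopTriple X Y A Z) {M : Submodule ℂ V}
    (hX : ∀ p, ∀ v ∈ M, X p v = 0) (hA : ∀ p, ∀ v ∈ M, A p v ∈ M)
    (hZ : ∀ r p, ∀ v ∈ M, Z r p v ∈ M) (p : G) (j : ℕ) :
    ∀ l : List G, l.length = j → ∀ v ∈ M,
      HasLeading j (fun t : ℕ => (X (t • p) ^ j) ((l.map fun r => Y (r - t • p)).prod v))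
        ((j.factorial : ℂ) • (l.map fun r => Z r p).prod v) := by
  induction j with
  | zero =>
    intro l hl v _ f
    obtain rfl := List.length_eq_zero_iff.1 hl
    exact ⟨Polynomial.C (f v), by simp, by simp, by simp⟩
  | succ j ih =>
    -- an `A r` amid `j` lowering operators contributes no term of degree `j + 1`
    have hcartan : ∀ b a : List G, ∀ r, ∀ v ∈ M, a.length + b.length = j →
        HasLeading (j + 1) (fun t : ℕ => (X (t • p) ^ j) ((a.map fun r => Y (r - t • p)).prod
          (A r ((b.map fun r => Y (r - t • p)).prod v)))) 0 := by
      intro b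
      induction b with
      | nil =>
        intro a r v hv hab
        simpa using (ih a (by simpa using hab) (A r v) (hA r v hv)).succ_zero
      | cons q b ihb =>
        intro a r v hv hab
        rw [List.length_cons] at hab
        have h1 := ihb (a ++ [q]) r v hv (by simp; omega)
        have h2 := (ih (a ++ (r + q) :: b) (by simp; omega) v hv).succ_zero.smul (-2)
        convert h1.add h2 using 1
        · funext t
          simp only [List.map_append, List.map_cons, List.map_nil, List.prod_append,
            List.prod_cons, List.prod_nil, mul_one, Module.End.mul_apply]
          have h3 := LinearMap.congr_fun (h.cartan_mul_lower r (q - t • p))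
            ((b.map fun r => Y (r - t • p)).prod v)
          simp only [Module.End.mul_apply, LinearMap.sub_apply, LinearMap.smul_apply] at h3
          rw [h3, ← add_sub_assoc r q, map_sub, map_sub, map_smul, map_smul]
          module
        · simp
    -- an `X (t p)` with `b` to its right contributes one leading term `j! Z ⋯ Z v` for each entry of `b`
    have hraise : ∀ b a : List G, ∀ v ∈ M, a.length + b.length = j + 1 →
        HasLeading (j + 1) (fun t : ℕ => (X (t • p) ^ j) ((a.map fun r => Y (r - t • p)).prod
          (X (t • p) ((b.map fun r => Y (r - t • p)).prod v))))
          ((b.length * j.factorial : ℂ) • ((a ++ b).map fun r => Z r p).prod v) := by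
      intro b
      induction b with
      | nil =>
        intro a v hv hab f
        exact ⟨0, by simp, by simp, fun t => by simp [hX _ v hv]⟩
      | cons q b ihb =>
        intro a v hv hab
        rw [List.length_cons] at hab
        have h1 := ihb (a ++ [q]) v hv (by simp; omega)
        have h2 := hcartan b a q v hv (by omega)
        have h3 := (ih (a ++ b) (by simp; omega) (Z q p v) (hZ q p v hv)).natCast_smul
        convert (h1.add h2).add h3 using 1
        · funext t
          have h4 := LinearMap.congr_fun (h.raise_mul_lower (t • p) (q - t • p))
            ((b.map fun r => Y (r - t • p)).prod v)
          have h5 := LinearMap.congr_fun (Commute.list_prod_right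
            (b.map fun r => Y (r - t • p)) (Z q p) (by
              intro y hy
              obtain ⟨r, _, rfl⟩ := List.mem_map.1 hy
              exact h.commute_lower _ _ _)).eq v
          simp only [Module.End.mul_apply, LinearMap.add_apply, add_sub_cancel,
            h.central_nsmul, LinearMap.smul_apply] at h4 h5
          simp only [List.map_append, List.map_cons, List.map_nil, List.prod_append,
            List.prod_cons, List.prod_nil, mul_one, Module.End.mul_apply, h4, h5, map_add,
            map_smul]
          abel
        · have h5 := LinearMap.congr_fun (Commute.list_prod_right
            (b.map fun r => Z r p) (Z q p) (by
              intro y hy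
              obtain ⟨r, _, rfl⟩ := List.mem_map.1 hy
              exact h.commute_central _ _ _ _)).eq v
          simp only [Module.End.mul_apply] at h5
          simp only [List.map_append, List.map_cons, List.map_nil, List.prod_append,
            List.prod_cons, List.prod_nil, mul_one, Module.End.mul_apply, h5,
            List.length_cons, add_zero]
          push_cast
          module
    intro l hl v hv
    have h1 := hraise l [] v hv (by simpa using hl)
    rw [hl] at h1
    simpa [pow_succ, Nat.factorial_succ] using h1

/-- If all products of `N` lowering operators kill a space of highest weight vectors, then so do all
products of `N` operators `Z r p` with the same `p`. -/
theorem prod_central_apply_eq_zero (h : IsLoopTriple X Y A Z) {M : Submodule ℂ V}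
    (hX : ∀ p, ∀ v ∈ M, X p v = 0) (hA : ∀ p, ∀ v ∈ M, A p v ∈ M)
    (hZ : ∀ r p, ∀ v ∈ M, Z r p v ∈ M) {N : ℕ}
    (hY : ∀ l : List G, l.length = N → ∀ v ∈ M, (l.map Y).prod v = 0)
    (p : G) {l : List G} (hl : l.length = N) {v : V} (hv : v ∈ M) :
    (l.map fun r => Z r p).prod v = 0 := by
  have h1 := h.hasLeading hX hA hZ p N l hl v hv
  have h2 : ∀ t : ℕ, (l.map fun r => Y (r - t • p)).prod v = 0 := fun t => by
    have := hY (l.map fun r => r - t • p) (by simpa using hl) v hv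
    rwa [List.map_map] at this
  simp only [h2, map_zero] at h1
  exact (smul_eq_zero.1 h1.eq_zero).resolve_left (by exact_mod_cast N.factorial_ne_zero)

end IsLoopTriple

end LoopTriple

/-! ### Common kernels of nilpotent families -/

section CommonKernel

variable {G V : Type*} [AddCommGroup V] [Module ℂ V]

theorem exists_prod_ne_zero_of_prod_eq_zero (T : G → Module.End ℂ V) {N : ℕ} {v : V} (hv : v ≠ 0)
    (hN : ∀ l : List G, l.length = N → (l.map T).prod v = 0) :
    ∃ l : List G, (l.map T).prod v ≠ 0 ∧ ∀ r, T r ((l.map T).prod v) = 0 := by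
  induction N with
  | zero => exact absurd (hN [] rfl) (by simpa using hv)
  | succ N ih =>
    by_cases h : ∀ l : List G, l.length = N → (l.map T).prod v = 0
    · exact ih h
    · push Not at h
      obtain ⟨l, hl, hne⟩ := h
      exact ⟨l, hne, fun r => by simpa using hN (r :: l) (by simpa using hl)⟩

theorem list_prod_apply_mem {M : Submodule ℂ V} (l : List (Module.End ℂ V))
    (hl : ∀ T ∈ l, ∀ v ∈ M, T v ∈ M) {v : V} (hv : v ∈ M) : l.prod v ∈ M := by
  induction l with
  | nil => simpa using hv
  | cons T l ih =>
    rw [List.prod_cons]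
    exact hl T (by simp) _ (ih fun S hS => hl S (by simp [hS]))

/-- Finitely many families of commuting operators, each of which is nilpotent of bounded length, have
a common null vector. -/
theorem exists_common_kernel {ι : Type*} (s : Finset ι) (T : ι → G → Module.End ℂ V)
    (hcomm : ∀ i r j q, Commute (T i r) (T j q)) {M : Submodule ℂ V} (hM : M ≠ ⊥)
    (hT : ∀ i r, ∀ v ∈ M, T i r v ∈ M) {N : ℕ}
    (hN : ∀ i, ∀ l : List G, l.length = N → ∀ v ∈ M, (l.map (T i)).prod v = 0) :
    ∃ v ∈ M, v ≠ 0 ∧ ∀ i ∈ s, ∀ r, T i r v = 0 := by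
  classical
  induction s using Finset.induction_on with
  | empty =>
    obtain ⟨v, hv, hv0⟩ := M.exists_mem_ne_zero_of_ne_bot hM
    exact ⟨v, hv, hv0, by simp⟩
  | insert j s _ ih =>
    obtain ⟨v, hv, hv0, hs⟩ := ih
    obtain ⟨l, hl0, hl⟩ := exists_prod_ne_zero_of_prod_eq_zero (T j) hv0 fun l hl => hN j l hl v hv
    refine ⟨(l.map (T j)).prod v, list_prod_apply_mem _ ?_ hv, hl0, fun i hi r => ?_⟩
    · intro S hS
      obtain ⟨r, _, rfl⟩ := List.mem_map.1 hS
      exact hT j r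
    · rcases Finset.mem_insert.1 hi with rfl | hi
      · exact hl r
      · have h5 := LinearMap.congr_fun (Commute.list_prod_right (l.map (T j)) (T i r) (by
          intro y hy
          obtain ⟨q, _, rfl⟩ := List.mem_map.1 hy
          exact hcomm _ _ _ _)).eq v
        simp only [Module.End.mul_apply] at h5
        rw [h5, hs i hi r, map_zero]

end CommonKernel

/-! ### Null vectors of the central operators -/

namespace IsLoopTriple

variable {G V : Type*} [AddCommGroup G] [AddCommGroup V] [Module ℂ V]
  {X Y A : G → Module.End ℂ V} {Z : G → G → Module.End ℂ V}

/-- The weights of an integrable graded representation are bounded above and below, so that there is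
a highest weight space `⨆ P, W k P`, on which long products of lowering operators vanish; hence so do
long products of the `Z r p`. -/
theorem exists_central_null_vector (h : IsLoopTriple X Y A Z)
    (hcartan : ∀ p, A 0 * X p = X p * A 0 + (2 : ℂ) • X p) (hZ0 : ∀ p, Z 0 p = 0)
    (hX : ∀ p v, ∃ N, (X p ^ N) v = 0) (hY : ∀ p v, ∃ N, (Y p ^ N) v = 0)
    {W : ℤ → G → Submodule ℂ V} (hfin : ∀ k, FiniteDimensional ℂ (W k 0)) (hW : W 0 0 ≠ ⊥) {c : ℂ}
    (hH : ∀ k P, ∀ v ∈ W k P, A 0 v = (c + 2 * k) • v)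
    (hXW : ∀ k P p, ∀ v ∈ W k P, X p v ∈ W (k + 1) (P + p))
    (hYW : ∀ k P p, ∀ v ∈ W k P, Y p v ∈ W (k - 1) (P + p))
    (hAW : ∀ k P p, ∀ v ∈ W k P, A p v ∈ W k (P + p))
    (hZW : ∀ k P r p, ∀ v ∈ W k P, Z r p v ∈ W k (P + r)) (s : Finset G) :
    ∃ v : V, v ≠ 0 ∧ ∀ p ∈ s, ∀ r, Z r p v = 0 := by
  have hXY : ∀ p v, X p (Y (-p) v) = Y (-p) (X p v) + A 0 v := fun p v => by
    simpa [hZ0] using LinearMap.congr_fun (h.raise_mul_lower p (-p)) v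
  have hAX : ∀ p v, A 0 (X p v) = X p (A 0 v) + (2 : ℂ) • X p v := fun p v => by
    simpa using LinearMap.congr_fun (hcartan p) v
  have hAY : ∀ p v, A 0 (Y p v) = Y p (A 0 v) - (2 : ℂ) • Y p v := fun p v => by
    simpa using LinearMap.congr_fun (h.cartan_mul_lower 0 p) v
  obtain ⟨K, hK⟩ := exists_weight_bound hXY hAX hX hfin hH hXW hYW
  obtain ⟨K', hK'⟩ := exists_weight_bound (X := Y) (Y := X) (H := -A 0) (c := -c)
    (W := fun k P => W (-k) P)
    (fun p v => by
      have := hXY (-p) v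
      rw [neg_neg] at this
      rw [this, LinearMap.neg_apply, add_neg_cancel_right])
    (fun p v => by
      rw [LinearMap.neg_apply, LinearMap.neg_apply, hAY, map_neg]
      abel)
    hY (fun k => hfin _)
    (fun k P v hv => by
      rw [LinearMap.neg_apply, hH _ _ v hv]
      push_cast
      module)
    (fun k P p v hv => by
      rw [show -(k + 1) = -k - 1 by ring]
      exact hYW _ _ p v hv)
    (fun k P p v hv => by
      rw [show -(k - 1) = -k + 1 by ring]
      exact hXW _ _ p v hv)
  -- the highest `k` with a nonzero weight space
  obtain ⟨k, ⟨P₀, hk⟩, hmax⟩ := Int.exists_greatest_of_bdd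
    (P := fun k => ∃ P, W k P ≠ ⊥)
    ⟨K, fun k ⟨P, hP⟩ => by
      by_contra hlt
      exact hP ((Submodule.eq_bot_iff _).2 (hK k (by omega) P))⟩
    ⟨0, 0, hW⟩
  let M : Submodule ℂ V := ⨆ P, W k P
  have hle : ∀ P, W k P ≤ M := fun P => le_iSup (W k) P
  have hM : M ≠ ⊥ := fun h0 => hk (le_bot_iff.1 (h0 ▸ hle P₀))
  have hXM : ∀ p, ∀ v ∈ M, X p v = 0 := fun p => by
    have : M ≤ LinearMap.ker (X p) := iSup_le fun P v hv => by
      by_contra hne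
      have := hmax (k + 1) ⟨P + p, fun h0 => hne ?_⟩
      · omega
      · have := hXW k P p v hv
        rwa [h0, Submodule.mem_bot] at this
    exact this
  have hAM : ∀ p, ∀ v ∈ M, A p v ∈ M := fun p => by
    have : M ≤ M.comap (A p) := iSup_le fun P v hv => hle _ (hAW k P p v hv)
    exact this
  have hZM : ∀ r p, ∀ v ∈ M, Z r p v ∈ M := fun r p => by
    have : M ≤ M.comap (Z r p) := iSup_le fun P v hv => hle _ (hZW k P r p v hv)
    exact this
  have hYprod : ∀ l : List G, ∀ P, ∀ v ∈ W k P, ∃ P', (l.map Y).prod v ∈ W (k - l.length) P' := by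
    intro l P v hv
    induction l with
    | nil => exact ⟨P, by simpa using hv⟩
    | cons q l ih =>
      obtain ⟨P', hP'⟩ := ih
      refine ⟨P' + q, ?_⟩
      have := hYW _ _ q _ hP'
      rw [List.map_cons, List.prod_cons, Module.End.mul_apply, List.length_cons]
      convert this using 2
      push_cast
      ring
  have hYM : ∀ l : List G, l.length = (k + K').toNat → ∀ v ∈ M, (l.map Y).prod v = 0 := by
    intro l hl
    have : M ≤ LinearMap.ker (l.map Y).prod := iSup_le fun P v hv => by
      obtain ⟨P', hP'⟩ := hYprod l P v hv
      exact hK' (l.length - k) (by omega) P' _ (by rwa [neg_sub])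
    exact this
  obtain ⟨v, -, hv0, hv⟩ := exists_common_kernel s (fun p r => Z r p)
    (fun p r q s => h.commute_central r p s q) hM (fun p r => hZM r p)
    (fun p l hl v hv => h.prod_central_apply_eq_zero hXM hAM hZM hYM p hl hv)
  exact ⟨v, hv0, hv⟩

end IsLoopTriple

/-! ### An `sl₂`-triple in the fixed point subalgebra -/

section FixedPoints

theorem exists_nonZero_weight {L : Type*} [LieRing L] [LieAlgebra ℂ L] [FiniteDimensional ℂ L]
    [LieAlgebra.IsSimple ℂ L] (H : LieSubalgebra ℂ L) [H.IsCartanSubalgebra] :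
    ∃ α : LieModule.Weight ℂ H L, α.IsNonZero := by
  by_contra! hall
  have hspan := LieAlgebra.IsKilling.span_weight_isNonZero_eq_top (K := ℂ) (L := L) H
  have hempty : {α : LieModule.Weight ℂ H L | α.IsNonZero} = ∅ :=
    Set.eq_empty_of_forall_notMem fun α hα => hα (hall α)
  rw [hempty, Set.image_empty, Submodule.span_empty] at hspan
  have hH0 : ∀ h : H, h = 0 := fun h => by
    rw [← Module.forall_dual_apply_eq_zero_iff ℂ]
    intro f
    have hf : f ∈ (⊥ : Submodule ℂ (Module.Dual ℂ H)) := hspan ▸ Submodule.mem_top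
    rw [(Submodule.mem_bot ℂ).1 hf, LinearMap.zero_apply]
  -- the normalizer of the zero subalgebra is everything
  refine LieAlgebra.IsSimple.non_abelian ℂ (L := L) ⟨fun x y => ?_⟩
  have hmem : ∀ z : L, z ∈ H := fun z => by
    rw [← LieSubalgebra.IsCartanSubalgebra.self_normalizing (H := H),
      LieSubalgebra.mem_normalizer_iff]
    intro w hw
    have : w = 0 := congrArg Subtype.val (hH0 ⟨w, hw⟩)
    rw [this]
    simp
  have : x = 0 := congrArg Subtype.val (hH0 ⟨x, hmem x⟩)
  rw [this, zero_lie]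

variable {n : ℕ} {g : Type*} [LieRing g] [LieAlgebra ℂ g] (S : AutTuple n g)

theorem AutTuple.σ_apply_fixed (x : S.fixed) (i : Fin n) : S.σ i (x : g) = x := by
  have : (x : g) ∈ S.eigenpart 0 := x.2
  simpa using this i

theorem AutTuple.mem_fixed {y : g} (hy : ∀ i, S.σ i y = y) : y ∈ S.fixed := by
  have : y ∈ S.eigenpart 0 := fun i => by simpa using hy i
  exact this

variable [FiniteDimensional ℂ g] [LieAlgebra.IsSimple ℂ g] (B : InvariantForm g)

/-- An element of `g(0̄)` orthogonal to `g(0̄)` is orthogonal to `g`: averaging over the powers of the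
`σ i` does not change the pairing with a fixed point. -/
theorem AutTuple.form_eq_zero_of_forall_fixed {x : S.fixed}
    (hx : ∀ y : S.fixed, B.form (x : g) y = 0) (y : g) : B.form (x : g) y = 0 := by
  have key : ∀ (s : Finset (Fin n)) (y : g), (∀ i ∉ s, S.σ i y = y) → B.form (x : g) y = 0 := by
    intro s
    induction s using Finset.induction_on with
    | empty =>
      intro y hy
      exact hx ⟨y, S.mem_fixed fun i => hy i (by simp)⟩
    | insert j s _ ih =>
      intro y hy
      let T : Module.End ℂ g := ((S.σ j).toLinearEquiv : g →ₗ[ℂ] g)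
      have hT : ∀ z, T z = S.σ j z := fun z => rfl
      have hTm : T ^ S.m j = 1 := by
        have h1 := pow_orderOf_eq_one (S.σ j).toLinearEquiv
        rw [S.order_eq] at h1
        have h2 : ∀ k : ℕ, T ^ k = (((S.σ j).toLinearEquiv ^ k : g ≃ₗ[ℂ] g) : g →ₗ[ℂ] g) := by
          intro k
          induction k with
          | zero => rfl
          | succ k ihk => rw [pow_succ, pow_succ, ihk]; rfl
        rw [h2, h1]
        rfl
      have hform : ∀ k : ℕ, B.form (x : g) ((T ^ k) y) = B.form (x : g) y := by
        intro k
        induction k with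
        | zero => simp
        | succ k ihk =>
          rw [pow_succ', Module.End.mul_apply, hT]
          nth_rewrite 1 [← S.σ_apply_fixed x j]
          rw [B.map_equiv, ihk]
      have hcomm : ∀ i ∉ insert j s, ∀ k : ℕ, S.σ i ((T ^ k) y) = (T ^ k) y := by
        intro i hi k
        induction k with
        | zero => simpa using hy i hi
        | succ k ihk => rw [pow_succ', Module.End.mul_apply, hT, S.commute, ihk]
      have hsum := ih (∑ k ∈ Finset.range (S.m j), (T ^ k) y) (by
        intro i hi
        by_cases hij : i = j
        · subst hij
          have h3 : ∀ k, S.σ i ((T ^ k) y) = (T ^ (k + 1)) y := fun k => by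
            rw [pow_succ', Module.End.mul_apply, hT]
          have h4 := Finset.sum_range_succ' (fun k => (T ^ k) y) (S.m i)
          rw [Finset.sum_range_succ, hTm, pow_zero] at h4
          rw [map_sum, Finset.sum_congr rfl fun k _ => h3 k]
          exact (add_right_cancel h4).symm
        · rw [map_sum]
          exact Finset.sum_congr rfl fun k _ => hcomm i (by simp [hij, hi]) k)
      rw [map_sum, Finset.sum_congr rfl fun k _ => hform k, Finset.sum_const, Finset.card_range,
        nsmul_eq_mul] at hsum
      exact (mul_eq_zero.1 hsum).resolve_left (by exact_mod_cast (S.m_pos j).ne')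
  exact key Finset.univ y (by simp)

/-- The restriction of the form to `g(0̄)`. -/
def InvariantForm.restrictFixed : InvariantForm S.fixed where
  form := B.form.restrict S.fixed.toSubmodule
  symm x y := B.symm x y
  invariant x y z := B.invariant x y z
  nondegenerate := by
    have hl : (B.form.restrict S.fixed.toSubmodule).SeparatingLeft := fun x hx =>
      Subtype.ext (B.nondegenerate.1 x (S.form_eq_zero_of_forall_fixed B hx))
    refine ⟨hl, fun y hy => hl y fun x => ?_⟩
    exact (B.symm y x).trans (hy x)

/-- A root `α` of `g(0̄)`, with an `sl₂`-triple `(h, e, f)` in `g(0̄)` through the root spaces of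
`± α`; the form pairs `e` and `f` nontrivially. -/
theorem AutTuple.exists_sl2Triple [LieAlgebra.IsSimple ℂ S.fixed] (H₀ : LieSubalgebra ℂ S.fixed)
    [H₀.IsCartanSubalgebra] :
    ∃ (α : Module.Dual ℂ H₀) (h : H₀) (e f : S.fixed), α ∈ S.roots H₀ ∧
      -α ∈ S.roots H₀ ∧ (e : g) ∈ S.rootPart H₀ 0 α ∧ (f : g) ∈ S.rootPart H₀ 0 (-α) ∧
      ⁅e, f⁆ = (h : S.fixed) ∧ α h = 2 ∧ B.form (e : g) f ≠ 0 := by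
  obtain ⟨α, hα⟩ := exists_nonZero_weight H₀
  obtain ⟨h, e, f, ht, he, hf⟩ := LieAlgebra.IsKilling.exists_isSl2Triple_of_weight_isNonZero hα
  have hef := LieAlgebra.IsKilling.lie_eq_killingForm_smul_of_mem_rootSpace_of_mem_rootSpace_neg
    he hf
  have hh : h ∈ H₀ := by
    rw [← ht.lie_e_f, hef]
    exact H₀.smul_mem _ (Submodule.coe_mem _)
  have hκ : killingForm ℂ S.fixed e f ≠ 0 := fun h0 => ht.h_ne_zero <| by
    rw [← ht.lie_e_f, hef, h0, zero_smul]
  have hne : e ≠ 0 := ht.e_ne_zero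
  have hnf : f ≠ 0 := ht.f_ne_zero
  have he' := fun z : H₀ => LieAlgebra.IsKilling.lie_eq_smul_of_mem_rootSpace he z
  have hf' := fun z : H₀ => LieAlgebra.IsKilling.lie_eq_smul_of_mem_rootSpace hf z
  have hα0 : LieModule.Weight.toLinear ℂ H₀ S.fixed α ≠ 0 :=
    (LieModule.Weight.coe_toLinear_ne_zero_iff).2 hα
  have hαh : α ⟨h, hh⟩ = 2 := by
    have h1 : ⁅h, e⁆ = α ⟨h, hh⟩ • e := he' ⟨h, hh⟩
    rw [ht.lie_h_e_nsmul] at h1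
    have h2 : ((2 : ℂ) - α ⟨h, hh⟩) • e = 0 := by
      rw [sub_smul, ← h1]
      module
    exact (sub_eq_zero.1 ((smul_eq_zero.1 h2).resolve_right hne)).symm
  have hex : ∀ z : H₀, ⁅((z : S.fixed) : g), (e : g)⁆ =
      LieModule.Weight.toLinear ℂ H₀ S.fixed α z • (e : g) :=
    fun z => congrArg Subtype.val (he' z)
  have hfx : ∀ z : H₀, ⁅((z : S.fixed) : g), (f : g)⁆ =
      (-LieModule.Weight.toLinear ℂ H₀ S.fixed α) z • (f : g) :=
    fun z => congrArg Subtype.val (hf' z)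
  refine ⟨LieModule.Weight.toLinear ℂ H₀ S.fixed α, ⟨h, hh⟩, e, f, ⟨hα0, e, e.2, ?_, hex⟩,
    ⟨neg_ne_zero.2 hα0, f, f.2, ?_, hfx⟩, ⟨e.2, hex⟩, ⟨f.2, hfx⟩, ht.lie_e_f, hαh, ?_⟩
  · simpa using hne
  · simpa using hnf
  · obtain ⟨c, hc⟩ := (B.restrictFixed S).eq_smul_killingForm
    have hc0 : c ≠ 0 := by
      rintro rfl
      refine hne ((B.restrictFixed S).nondegenerate.1 e fun y => ?_)
      rw [hc, zero_mul]
    have : B.form (e : g) f = c * killingForm ℂ S.fixed e f := hc e f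
    rw [this]
    exact mul_ne_zero hc0 hκ

end FixedPoints

end ToroidalEALA

noncomputable section

namespace ToroidalEALA

open FullToroidal

/-! ### Brackets in the twisted toroidal algebra -/

section Brackets

variable {n : ℕ} {g : Type*} [LieRing g] [LieAlgebra ℂ g]

theorem AutTuple.fixed_mem_eigenpart (S : AutTuple n g) (p : S.Γ) (x : S.fixed) :
    (x : g) ∈ S.eigenpart p := by
  have h := S.eigenpart_add_of_mem p.2 x.2
  rwa [zero_add] at h

variable (B : InvariantForm g) (c₁ c₂ : ℂ)

theorem FullToroidal.central_add (k : Exponent n) (a b : Fin n → ℂ) :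
    central B c₁ c₂ k (a + b) = central B c₁ c₂ k a + central B c₁ c₂ k b := by
  simp only [central, ← map_add, ← Finsupp.single_add, Prod.mk_add_mk, add_zero]

theorem FullToroidal.central_smul (k : Exponent n) (c : ℂ) (a : Fin n → ℂ) :
    central B c₁ c₂ k (c • a) = c • central B c₁ c₂ k a := by
  simp only [central, ← map_smul, Finsupp.smul_single, Prod.smul_mk, smul_zero]

/-- The part of degree zero, without its component in the span of the `K_i`. -/
def FullToroidal.zeroPart : FullToroidal n B c₁ c₂ →ₗ[ℂ] g × (Fin n → ℂ) :=
  (exactForms n g).liftQ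
    ((LinearMap.prodMap LinearMap.id (LinearMap.snd ℂ (Fin n → ℂ) (Fin n → ℂ))) ∘ₗ
      Finsupp.lapply 0) (by
    rw [exactForms, Submodule.span_le]
    rintro _ ⟨k, rfl⟩
    rw [SetLike.mem_coe, LinearMap.mem_ker]
    by_cases hk : k = 0
    · subst hk
      simp
    · simp [hk])

theorem FullToroidal.zeroPart_mk_single_zero (e : Coeff n g) :
    zeroPart B c₁ c₂ (mk n B c₁ c₂ (Finsupp.single 0 e)) = (e.1, e.2.2) := by
  have : zeroPart B c₁ c₂ (mk n B c₁ c₂ (Finsupp.single 0 e)) =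
    ((LinearMap.prodMap LinearMap.id (LinearMap.snd ℂ (Fin n → ℂ) (Fin n → ℂ))) ∘ₗ
      Finsupp.lapply 0) (Finsupp.single (0 : Exponent n) e) := rfl
  rw [this]
  simp

/-- The linear functional of degree `P` whose value at `x + ∑ i, a i • K_i + ∑ i, u i • d_i` is
`β x + (u|P)`. -/
def FullToroidal.functional (β : Module.Dual ℂ g) (P : Exponent n) :
    Module.Dual ℂ (FullToroidal n B c₁ c₂) :=
  (β.coprod (dotProductBilin ℂ ℂ |>.flip (cvec P))) ∘ₗ zeroPart B c₁ c₂

theorem FullToroidal.functional_mk_single_zero (β : Module.Dual ℂ g) (P : Exponent n)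
    (e : Coeff n g) :
    functional B c₁ c₂ β P (mk n B c₁ c₂ (Finsupp.single 0 e)) = β e.1 + e.2.2 ⬝ᵥ cvec P := by
  simp [functional, zeroPart_mk_single_zero, dotProductBilin]

variable [FiniteDimensional ℂ g] [LieAlgebra.IsSimple ℂ g] (S : AutTuple n g)

/-- The element `x ⊗ t^p` of `τ`, for `p ∈ Γ` and `x ∈ g(0̄)`. -/
def fixedLoop (p : S.Γ) (x : S.fixed) : twisted S B c₁ c₂ :=
  loopElt B (p : Exponent n) ⟨x, S.fixed_mem_eigenpart p x⟩

/-- The element `∑ i, a i • t^r K_i` of `τ`, for `r ∈ Γ`. -/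
def centralElt (r : S.Γ) : (Fin n → ℂ) →ₗ[ℂ] twisted S B c₁ c₂ where
  toFun a := ⟨central B c₁ c₂ r a, Submodule.mem_sup_left (Submodule.mem_sup_right
    (Submodule.subset_span ⟨r, r.2, a, rfl⟩))⟩
  map_add' a b := Subtype.ext (central_add B c₁ c₂ r a b)
  map_smul' c a := Subtype.ext (central_smul B c₁ c₂ r c a)

theorem lie_fixedLoop (p q : S.Γ) (x y : S.fixed) :
    ⁅fixedLoop B c₁ c₂ S p x, fixedLoop B c₁ c₂ S q y⁆ = fixedLoop B c₁ c₂ S (p + q) ⁅x, y⁆ +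
      B.form (x : g) y • centralElt B c₁ c₂ S (p + q) (cvec p) := by
  refine Subtype.ext ?_
  change ⁅mk n B c₁ c₂ _, mk n B c₁ c₂ _⁆ =
    mk n B c₁ c₂ (Finsupp.single ((p : Exponent n) + q) _) +
      B.form (x : g) y • mk n B c₁ c₂ (Finsupp.single ((p : Exponent n) + q) _)
  rw [lie_mk_single, ← map_smul, Finsupp.smul_single, ← map_add, ← Finsupp.single_add]
  simp [bracketFun]

theorem fixedLoop_smul (p : S.Γ) (c : ℂ) (x : S.fixed) :
    fixedLoop B c₁ c₂ S p (c • x) = c • fixedLoop B c₁ c₂ S p x := by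
  refine Subtype.ext ?_
  change mk n B c₁ c₂ _ = _ • mk n B c₁ c₂ _
  rw [← map_smul, Finsupp.smul_single]
  simp

theorem lie_centralElt_fixedLoop (r q : S.Γ) (a : Fin n → ℂ) (y : S.fixed) :
    ⁅centralElt B c₁ c₂ S r a, fixedLoop B c₁ c₂ S q y⁆ = 0 := by
  refine Subtype.ext ?_
  change ⁅mk n B c₁ c₂ _, mk n B c₁ c₂ _⁆ = 0
  rw [lie_mk_single]
  exact mk_single_eq_zero B c₁ c₂ _ 0 (by simp [bracketFun])

theorem lie_centralElt_centralElt (r s : S.Γ) (a b : Fin n → ℂ) :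
    ⁅centralElt B c₁ c₂ S r a, centralElt B c₁ c₂ S s b⁆ = 0 := by
  refine Subtype.ext ?_
  change ⁅mk n B c₁ c₂ _, mk n B c₁ c₂ _⁆ = 0
  rw [lie_mk_single]
  exact mk_single_eq_zero B c₁ c₂ _ 0 (by simp [bracketFun])

variable {S} (H₀ : LieSubalgebra ℂ S.fixed)

/-- The restriction of `functional` to the Cartan subalgebra `H` of `τ`. -/
def cartanFunctional (β : Module.Dual ℂ g) (P : Exponent n) :
    Module.Dual ℂ (cartan B c₁ c₂ H₀) :=
  functional B c₁ c₂ β P ∘ₗ (twisted S B c₁ c₂).toSubmodule.subtype ∘ₗ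
    (cartan B c₁ c₂ H₀).subtype

theorem cartanFunctional_add (β β' : Module.Dual ℂ g) (P P' : Exponent n) :
    cartanFunctional B c₁ c₂ H₀ (β + β') (P + P') =
      cartanFunctional B c₁ c₂ H₀ β P + cartanFunctional B c₁ c₂ H₀ β' P' := by
  ext h
  simp only [cartanFunctional, functional, LinearMap.comp_apply, LinearMap.coprod_apply,
    LinearMap.add_apply, cvec_add, map_add]
  ring

/-- To check that an element of `τ` is an eigenvector for `ad H`, it suffices to consider the
generators of `H`. -/
theorem lie_cartan_eq_smul {β : Module.Dual ℂ g} {P : Exponent n} {X : twisted S B c₁ c₂}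
    (h₁ : ∀ h : H₀, ⁅fixedLoop B c₁ c₂ S 0 h, X⁆ = β ((h : S.fixed) : g) • X)
    (h₂ : ∀ a, ⁅centralElt B c₁ c₂ S 0 a, X⁆ = 0)
    (h₃ : ∀ i, ⁅degreeD S B c₁ c₂ i, X⁆ = (P i : ℂ) • X) (h : cartan B c₁ c₂ H₀) :
    ⁅(h : twisted S B c₁ c₂), X⁆ = cartanFunctional B c₁ c₂ H₀ β P h • X := by
  obtain ⟨h, hh⟩ := h
  change ⁅h, X⁆ = functional B c₁ c₂ β P (h : FullToroidal n B c₁ c₂) • X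
  unfold cartan at hh
  induction hh using Submodule.span_induction with
  | zero => simp
  | add x y _ _ hx hy =>
    rw [add_lie, hx, hy, ← add_smul]
    exact congrArg (· • X) (map_add (functional B c₁ c₂ β P) _ _).symm
  | smul c x _ hx =>
    rw [smul_lie, hx, smul_smul]
    exact congrArg (· • X) (map_smul (functional B c₁ c₂ β P) _ _).symm
  | mem x hx =>
    rcases hx with (⟨z, rfl⟩ | ⟨i, rfl⟩) | ⟨i, rfl⟩
    · refine (h₁ z).trans ?_
      congr 1
      exact ((functional_mk_single_zero B c₁ c₂ β P _).trans (by simp)).symm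
    · refine (h₂ (Pi.single i 1)).trans ?_
      have : functional B c₁ c₂ β P (centralK S B c₁ c₂ i : FullToroidal n B c₁ c₂) = 0 :=
        (functional_mk_single_zero B c₁ c₂ β P _).trans (by simp)
      rw [this, zero_smul]
    · refine (h₃ i).trans ?_
      congr 1
      exact ((functional_mk_single_zero B c₁ c₂ β P _).trans (by simp [cvec])).symm

theorem lie_cartan_fixedLoop {β : Module.Dual ℂ g} {x : S.fixed}
    (hx : ∀ h : H₀, ⁅(h : S.fixed), x⁆ = β ((h : S.fixed) : g) • x) (p : S.Γ)
    (h : cartan B c₁ c₂ H₀) :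
    ⁅(h : twisted S B c₁ c₂), fixedLoop B c₁ c₂ S p x⁆ =
      cartanFunctional B c₁ c₂ H₀ β p h • fixedLoop B c₁ c₂ S p x := by
  refine lie_cartan_eq_smul B c₁ c₂ H₀ (fun h => ?_)
    (fun a => lie_centralElt_fixedLoop B c₁ c₂ S 0 p a x) (fun i => ?_) h
  · rw [lie_fixedLoop, zero_add, hx, fixedLoop_smul, AddSubgroup.coe_zero, cvec_zero, map_zero,
      smul_zero, add_zero]
  · refine Subtype.ext ?_
    change ⁅mk n B c₁ c₂ _, mk n B c₁ c₂ _⁆ = _ • mk n B c₁ c₂ _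
    rw [lie_mk_single, ← map_smul, Finsupp.smul_single, zero_add]
    simp [bracketFun, cvec]

theorem lie_cartan_centralElt (r : S.Γ) (a : Fin n → ℂ) (h : cartan B c₁ c₂ H₀) :
    ⁅(h : twisted S B c₁ c₂), centralElt B c₁ c₂ S r a⁆ =
      cartanFunctional B c₁ c₂ H₀ 0 r h • centralElt B c₁ c₂ S r a := by
  refine lie_cartan_eq_smul B c₁ c₂ H₀ (fun h => ?_)
    (fun b => lie_centralElt_centralElt B c₁ c₂ S 0 r b a) (fun i => ?_) h
  · rw [← lie_skew, lie_centralElt_fixedLoop, neg_zero, LinearMap.zero_apply, zero_smul]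
  · refine Subtype.ext ?_
    change ⁅mk n B c₁ c₂ _, mk n B c₁ c₂ _⁆ = _ • mk n B c₁ c₂ _
    rw [lie_mk_single, ← map_smul, Finsupp.smul_single, zero_add]
    simp [bracketFun, cvec_zero]
    simp [cvec]

/-- `Ω_{A_n(m)} / d_{A_n(m)}` is an ideal of `τ`. -/
theorem lie_mem_centralPart {z x : FullToroidal n B c₁ c₂} (hz : z ∈ centralPart S B c₁ c₂)
    (hx : x ∈ twisted S B c₁ c₂) : ⁅z, x⁆ ∈ centralPart S B c₁ c₂ := by
  have hx' : x ∈ loopPart S B c₁ c₂ ⊔ centralPart S B c₁ c₂ ⊔ divFieldPart S B c₁ c₂ := hx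
  rw [sup_eq_span] at hx'
  unfold centralPart at hz
  induction hz using Submodule.span_induction with
  | zero => rw [zero_lie]; exact zero_mem _
  | add a b _ _ ha hb => rw [add_lie]; exact add_mem ha hb
  | smul c a _ ha => rw [smul_lie]; exact Submodule.smul_mem _ c ha
  | mem z hz =>
  clear hx
  induction hx' using Submodule.span_induction with
  | zero => rw [lie_zero]; exact zero_mem _
  | add a b _ _ ha hb => rw [lie_add]; exact add_mem ha hb
  | smul c a _ ha => rw [lie_smul]; exact Submodule.smul_mem _ c ha
  | mem x hx =>
  obtain ⟨r, hr, a, rfl⟩ := hz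
  have key : ∀ (k : Exponent n) (e : Coeff n g), k ∈ S.Γ → e.1 = 0 → e.2.2 = 0 →
      mk n B c₁ c₂ (Finsupp.single k e) ∈ centralPart S B c₁ c₂ := by
    rintro k ⟨x, b, u⟩ hk rfl rfl
    exact Submodule.subset_span ⟨k, hk, b, rfl⟩
  rcases hx with (⟨p, x, _, rfl⟩ | ⟨p, hp, b, rfl⟩) | ⟨p, hp, u, _, rfl⟩
  · have : ⁅central B c₁ c₂ r a, loop B c₁ c₂ p x⁆ = 0 := by
      simp only [central, loop, lie_mk_single]
      exact mk_single_eq_zero B c₁ c₂ _ 0 (by simp [bracketFun])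
    rw [this]
    exact zero_mem _
  · simp only [central, lie_mk_single]
    exact key _ _ (add_mem hr hp) (by simp [bracketFun]) (by simp [bracketFun])
  · simp only [central, vectorField, lie_mk_single]
    exact key _ _ (add_mem hr hp) (by simp [bracketFun]) (by simp [bracketFun])

end Brackets

/-! ### Integrable modules on which the `K_i` vanish -/

section Modules

variable {n : ℕ} {g : Type*} [LieRing g] [LieAlgebra ℂ g] [FiniteDimensional ℂ g]
  [LieAlgebra.IsSimple ℂ g] {S : AutTuple n g} {B : InvariantForm g} {c₁ c₂ : ℂ}
  {H₀ : LieSubalgebra ℂ S.fixed}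
  {V : Type*} [AddCommGroup V] [Module ℂ V] [LieRingModule (twisted S B c₁ c₂) V]
  [LieModule ℂ (twisted S B c₁ c₂) V]

theorem lie_mem_weightSpace {X : twisted S B c₁ c₂} {lam μ : Module.Dual ℂ (cartan B c₁ c₂ H₀)}
    (hX : ∀ h : cartan B c₁ c₂ H₀, ⁅(h : twisted S B c₁ c₂), X⁆ = μ h • X) {v : V}
    (hv : v ∈ weightSpace H₀ V lam) : ⁅X, v⁆ ∈ weightSpace H₀ V (lam + μ) := by
  intro h
  rw [leibniz_lie, hX, hv h, smul_lie, lie_smul, LinearMap.add_apply, add_smul, add_comm]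

/-- The generators `m_i e_i` of the group `Γ`. -/
def AutTuple.basisΓ (S : AutTuple n g) (i : Fin n) : S.Γ :=
  ⟨Pi.single i (S.m i : ℤ), fun j => by
    by_cases h : j = i
    · subst h; simp
    · simp [h]⟩

theorem centralElt_lie_eq_zero (r : S.Γ) {v : V}
    (hv : ∀ i, ⁅centralElt B c₁ c₂ S r (cvec (S.basisΓ i : Exponent n)), v⁆ = 0) (a : Fin n → ℂ) :
    ⁅centralElt B c₁ c₂ S r a, v⁆ = 0 := by
  have ha : a = ∑ i, (a i * (S.m i : ℂ)⁻¹) • cvec (S.basisΓ i : Exponent n) := by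
    have hm : ∀ i, (S.m i : ℂ) ≠ 0 := fun i => by exact_mod_cast (S.m_pos i).ne'
    ext j
    rw [Finset.sum_apply, Finset.sum_eq_single j]
    · simp [AutTuple.basisΓ, cvec, hm]
    · intro i _ hij
      simp [AutTuple.basisΓ, cvec, hij.symm]
    · simp
  rw [ha, map_sum, sum_lie]
  exact Finset.sum_eq_zero fun i _ => by rw [map_smul, smul_lie, hv, smul_zero]

theorem lie_eq_zero_of_centralElt_lie {v : V}
    (hv : ∀ r a, ⁅centralElt B c₁ c₂ S r a, v⁆ = 0) (z : twisted S B c₁ c₂)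
    (hz : (z : FullToroidal n B c₁ c₂) ∈ centralPart S B c₁ c₂) : ⁅z, v⁆ = 0 := by
  have key : ∀ y ∈ centralPart S B c₁ c₂, ∃ hy : y ∈ twisted S B c₁ c₂,
      ⁅(⟨y, hy⟩ : twisted S B c₁ c₂), v⁆ = 0 := by
    intro y hy
    unfold centralPart at hy
    induction hy using Submodule.span_induction with
    | zero => exact ⟨zero_mem _, zero_lie v⟩
    | add a b _ _ ha hb =>
      obtain ⟨ha, ha'⟩ := ha
      obtain ⟨hb, hb'⟩ := hb
      exact ⟨add_mem ha hb, (add_lie (⟨a, ha⟩ : twisted S B c₁ c₂) ⟨b, hb⟩ v).trans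
        (by rw [ha', hb', add_zero])⟩
    | smul c a _ ha =>
      obtain ⟨ha, ha'⟩ := ha
      exact ⟨(twisted S B c₁ c₂).smul_mem c ha,
        (smul_lie c (⟨a, ha⟩ : twisted S B c₁ c₂) v).trans (by rw [ha', smul_zero])⟩
    | mem y hy =>
      obtain ⟨r, hr, a, rfl⟩ := hy
      exact ⟨_, hv ⟨r, hr⟩ a⟩
  exact (key z hz).2

/-- An integrable module on which the `K_i` vanish has a nonzero vector killed by
`Ω_{A_n(m)} / d_{A_n(m)}`, provided that it has a weight. -/
theorem exists_central_null_vector [H₀.IsCartanSubalgebra] (hS : S.IsLieTorus H₀)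
    (hint : IsIntegrable B c₁ c₂ H₀ V) (hK : ∀ i (v : V), ⁅centralK S B c₁ c₂ i, v⁆ = 0)
    {lam : Module.Dual ℂ (cartan B c₁ c₂ H₀)} (hlam : weightSpace H₀ V lam ≠ ⊥) :
    ∃ v : V, v ≠ 0 ∧ ∀ z : twisted S B c₁ c₂,
      (z : FullToroidal n B c₁ c₂) ∈ centralPart S B c₁ c₂ → ⁅z, v⁆ = 0 := by
  classical
  have := hS.simple
  obtain ⟨α, h, e, f, hα, hα', he, hf, hef, hαh, hB⟩ := S.exists_sl2Triple B H₀
  -- an extension of the root `α` to a functional on `g`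
  obtain ⟨β, hβ⟩ : ∃ β : Module.Dual ℂ g, ∀ z : H₀, β ((z : S.fixed) : g) = α z := by
    obtain ⟨π, hπ⟩ := LinearMap.exists_leftInverse_of_injective
      (S.fixed.toSubmodule.subtype ∘ₗ H₀.toSubmodule.subtype)
      (LinearMap.ker_eq_bot.2 (Subtype.val_injective.comp Subtype.val_injective))
    exact ⟨α ∘ₗ π, fun z => congrArg α (LinearMap.congr_fun hπ z)⟩
  have hze : ∀ z : H₀, ⁅(z : S.fixed), e⁆ = α z • e := fun z => Subtype.ext (he.2 z)
  have hzf : ∀ z : H₀, ⁅(z : S.fixed), f⁆ = (-α) z • f := fun z => Subtype.ext (hf.2 z)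
  have hhe : ⁅(h : S.fixed), e⁆ = (2 : ℂ) • e := by rw [hze, hαh]
  have hhf : ⁅(h : S.fixed), f⁆ = (-2 : ℂ) • f := by rw [hzf, LinearMap.neg_apply, hαh]
  have hzh : ∀ z : H₀, ⁅(z : S.fixed), (h : S.fixed)⁆ = 0 := fun z => by
    rw [← hef, leibniz_lie, hze, hzf, smul_lie, lie_smul, LinearMap.neg_apply, neg_smul,
      add_neg_cancel]
  have hBhf : B.form ((h : S.fixed) : g) (f : g) = 0 := by
    have : ((h : S.fixed) : g) = ⁅(e : g), (f : g)⁆ := congrArg Subtype.val hef.symm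
    rw [this, B.invariant, lie_self, map_zero]
  let ρ := LieModule.toEnd ℂ (twisted S B c₁ c₂) V
  have hmul : ∀ a b, ρ a * ρ b = ρ b * ρ a + ρ ⁅a, b⁆ := fun a b =>
    LinearMap.ext fun v => (leibniz_lie a b v).trans (add_comm _ _)
  have hcomm : ∀ a b, ⁅a, b⁆ = 0 → Commute (ρ a) (ρ b) := fun a b hab => by
    have := hmul a b
    rwa [hab, map_zero, add_zero] at this
  let X : S.Γ → Module.End ℂ V := fun p => ρ (fixedLoop B c₁ c₂ S p e)
  let Y : S.Γ → Module.End ℂ V := fun p => ρ (fixedLoop B c₁ c₂ S p f)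
  let A : S.Γ → Module.End ℂ V := fun p => ρ (fixedLoop B c₁ c₂ S p h)
  let Z : S.Γ → S.Γ → Module.End ℂ V := fun r p =>
    B.form (e : g) f • ρ (centralElt B c₁ c₂ S r (cvec p))
  have htriple : IsLoopTriple X Y A Z :=
    { raise_mul_lower := fun p q => by
        simp only [X, Y, A, Z]
        rw [hmul, lie_fixedLoop, hef, map_add, map_smul]
      cartan_mul_lower := fun p q => by
        simp only [Y, A]
        rw [hmul, lie_fixedLoop, hhf, hBhf, zero_smul, add_zero, fixedLoop_smul, map_smul,
          neg_smul, sub_eq_add_neg]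
      commute_lower := fun r p q =>
        (hcomm _ _ (lie_centralElt_fixedLoop B c₁ c₂ S r q _ f)).smul_left _
      commute_central := fun r p s q =>
        ((hcomm _ _ (lie_centralElt_centralElt B c₁ c₂ S r s _ _)).smul_left _).smul_right _
      central_nsmul := fun r t p => by
        have : cvec ((t • p : S.Γ) : Exponent n) = (t : ℂ) • cvec (p : Exponent n) := by
          ext i
          simp [cvec]
        simp only [Z]
        rw [this, map_smul, map_smul, smul_comm] }
  let W : ℤ → S.Γ → Submodule ℂ V := fun k P =>
    weightSpace H₀ V (lam + cartanFunctional B c₁ c₂ H₀ (k • β) P)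
  have hshift : ∀ (k l : ℤ) (P Q : S.Γ) (T : twisted S B c₁ c₂),
      (∀ z : cartan B c₁ c₂ H₀, ⁅(z : twisted S B c₁ c₂), T⁆ =
        cartanFunctional B c₁ c₂ H₀ (l • β) Q z • T) →
      ∀ v ∈ W k P, ρ T v ∈ W (k + l) (P + Q) := fun k l P Q T hT v hv => by
    have := lie_mem_weightSpace hT hv
    rwa [add_assoc, ← cartanFunctional_add, ← add_smul, ← AddSubgroup.coe_add] at this
  have hcentral : ∀ (k : ℤ) (P r : S.Γ) a, ∀ v ∈ W k P,
      ρ (centralElt B c₁ c₂ S r a) v ∈ W k (P + r) := fun k P r a v hv => by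
    have := hshift k 0 P r _ (fun z => by
      rw [zero_smul]
      exact lie_cartan_centralElt B c₁ c₂ H₀ r a z) v hv
    rwa [add_zero] at this
  -- `h`, as an element of the Cartan subalgebra of `τ`
  let h' : cartan B c₁ c₂ H₀ :=
    ⟨fixedLoop B c₁ c₂ S 0 h, Submodule.subset_span (Or.inl (Or.inl ⟨h, rfl⟩))⟩
  obtain ⟨v, hv0, hv⟩ := htriple.exists_central_null_vector (W := W) (c := lam h')
    (s := Finset.univ.image S.basisΓ)
    (fun p => by
      simp only [X, A]
      rw [hmul, lie_fixedLoop, hhe, zero_add, fixedLoop_smul, AddSubgroup.coe_zero, cvec_zero,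
        map_zero, smul_zero, add_zero, map_smul])
    (fun p => by
      have h0 : ∀ a, ρ (centralElt B c₁ c₂ S 0 a) = 0 := fun a => LinearMap.ext fun v => by
        have ha : a = ∑ i, a i • Pi.single i (1 : ℂ) := by
          ext j
          simp [Finset.sum_apply, Pi.single_apply]
        rw [ha, map_sum, map_sum, LinearMap.sum_apply]
        refine Finset.sum_eq_zero fun i _ => ?_
        rw [map_smul, map_smul, LinearMap.smul_apply]
        exact (congrArg (a i • ·) (hK i v)).trans (smul_zero _)
      simp only [Z]
      rw [h0, smul_zero])
    (fun p v => hint.locally_nilpotent p α (Or.inr (Or.inl hα)) hα.1 e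
      ⟨S.fixed_mem_eigenpart p e, he.2⟩ v)
    (fun p v => hint.locally_nilpotent p (-α) (Or.inr (Or.inl hα')) hα'.1 f
      ⟨S.fixed_mem_eigenpart p f, hf.2⟩ v)
    (fun k => hint.finite_dimensional _)
    (by
      have : W 0 0 = weightSpace H₀ V lam := by
        simp only [W]
        congr 1
        ext z
        simp [cartanFunctional, functional, cvec_zero]
      rwa [this])
    (fun k P v hv => by
      refine (hv h').trans ?_
      congr 1
      rw [LinearMap.add_apply]
      congr 1
      refine (functional_mk_single_zero B c₁ c₂ _ _ _).trans ?_
      simp [hβ, hαh, mul_comm])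
    (fun k P p v hv => hshift k 1 P p _ (fun z => by
      rw [one_smul]
      exact lie_cartan_fixedLoop B c₁ c₂ H₀ (fun z => by rw [hze, hβ]) p z) v hv)
    (fun k P p v hv => by
      rw [sub_eq_add_neg]
      exact hshift k (-1) P p _ (fun z => by
        rw [neg_smul, one_smul]
        exact lie_cartan_fixedLoop B c₁ c₂ H₀
          (fun z => by rw [hzf, LinearMap.neg_apply, LinearMap.neg_apply, hβ]) p z) v hv)
    (fun k P p v hv => by
      have := hshift k 0 P p _ (fun z => by
        rw [zero_smul]
        exact lie_cartan_fixedLoop B c₁ c₂ H₀ (β := 0) (x := h)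
          (fun z => by rw [hzh, LinearMap.zero_apply, zero_smul]) p z) v hv
      rwa [add_zero] at this)
    (fun k P r p v hv => Submodule.smul_mem _ _ (hcentral k P r _ v hv))
  refine ⟨v, hv0, lie_eq_zero_of_centralElt_lie fun r a => centralElt_lie_eq_zero r (fun i => ?_) a⟩
  exact (smul_eq_zero.1 (hv (S.basisΓ i) (by simp) r)).resolve_left hB

variable (V) in
/-- The submodule of vectors killed by `Ω_{A_n(m)} / d_{A_n(m)}`. -/
def centralNullSubmodule : LieSubmodule ℂ (twisted S B c₁ c₂) V where
  carrier := {v | ∀ z : twisted S B c₁ c₂,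
    (z : FullToroidal n B c₁ c₂) ∈ centralPart S B c₁ c₂ → ⁅z, v⁆ = 0}
  zero_mem' z _ := lie_zero z
  add_mem' hv hw z hz := by rw [lie_add, hv z hz, hw z hz, add_zero]
  smul_mem' c v hv z hz := by rw [lie_smul, hv z hz, smul_zero]
  lie_mem {x v} hv z hz := by
    rw [leibniz_lie, hv z hz, lie_zero, add_zero]
    exact hv _ (lie_mem_centralPart B c₁ c₂ hz x.2)

theorem exists_weightSpace_ne_bot [Nontrivial V] (hint : IsIntegrable B c₁ c₂ H₀ V) :
    ∃ lam : Module.Dual ℂ (cartan B c₁ c₂ H₀), weightSpace H₀ V lam ≠ ⊥ := by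
  classical
  by_contra! hall
  have h1 := hint.isInternal.submodule_iSup_eq_top
  rw [iSup_congr hall, iSup_bot] at h1
  exact bot_ne_top h1

end Modules

end ToroidalEALA

end

theorem mainTheorem2 {n : ℕ} {g : Type*} [LieRing g] [LieAlgebra ℂ g] [FiniteDimensional ℂ g]
    [LieAlgebra.IsSimple ℂ g]
    (S : ToroidalEALA.AutTuple n g)
    (H₀ : LieSubalgebra ℂ S.fixed) [H₀.IsCartanSubalgebra] (hS : S.IsLieTorus H₀)
    (B : ToroidalEALA.InvariantForm g) (c₁ c₂ : ℂ)
    (V : Type*) [AddCommGroup V] [Module ℂ V]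
    [LieRingModule (ToroidalEALA.twisted S B c₁ c₂) V]
    [LieModule ℂ (ToroidalEALA.twisted S B c₁ c₂) V]
    (hirr : LieModule.IsIrreducible ℂ (ToroidalEALA.twisted S B c₁ c₂) V)
    (hint : ToroidalEALA.IsIntegrable B c₁ c₂ H₀ V)
    (hK : ∀ (i : Fin n) (v : V), ⁅ToroidalEALA.centralK S B c₁ c₂ i, v⁆ = 0) :
    ∀ z : ToroidalEALA.twisted S B c₁ c₂,
      (z : ToroidalEALA.FullToroidal n B c₁ c₂) ∈ ToroidalEALA.centralPart S B c₁ c₂ →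
        ∀ v : V, ⁅z, v⁆ = 0 := by
  have : Nontrivial V := (LieSubmodule.nontrivial_iff ℂ _ V).1 hirr.toNontrivial
  obtain ⟨lam, hlam⟩ := ToroidalEALA.exists_weightSpace_ne_bot hint
  obtain ⟨v, hv0, hv⟩ := ToroidalEALA.exists_central_null_vector hS hint hK hlam
  have htop : ToroidalEALA.centralNullSubmodule (S := S) (B := B) (c₁ := c₁) (c₂ := c₂) V = ⊤ :=
    (hirr.eq_bot_or_eq_top _).resolve_left fun h => hv0 <| by
      have hmem : v ∈ ToroidalEALA.centralNullSubmodule (S := S) (B := B) (c₁ := c₁) (c₂ := c₂) V :=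
        hv
      rwa [h, LieSubmodule.mem_bot] at hmem
  intro z hz w
  have hw : w ∈ ToroidalEALA.centralNullSubmodule (S := S) (B := B) (c₁ := c₁) (c₂ := c₂) V :=
    htop ▸ LieSubmodule.mem_top w
  exact hw z hz
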